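/- For $k \le n$ let $\mathrm{St}(k,n) = \{A \in \mathrm{Mat}_{k\times n}(\mathbb{C}) : AA^T = \mathrm{id}_k\}$ be the complex Stiefel manifold and let $\mathrm{SO}(n) = \{A \in \mathrm{Mat}_{n\times n}(\mathbb{C}) : AA^T = \mathrm{id}_n,\ \det A = 1\}$, regarded as affine varieties in the respective spaces of matrices. The degree of an affine variety $X$ is $m!$ times the leading coefficient of its Hilbert polynomial, where $m=\dim X$ is the degree of that polynomial; the Hilbert polynomial is the polynomial which agrees for all large $t$ with the dimension of the space $\mathbb{C}[X]_{\le t}$ of restrictions to $X$ of polynomials of degree at most $t$. Then for every $n \ge 1$ $$\deg \mathrm{SO}(n) = \deg \mathrm{St}(n-1,n).$$ Moreover, let $\overline{\mathrm{SO}(n)}$ and $\overline{\mathrm{St}(n-1,n)}$ be the Zariski closures in $\mathbb{P}(\mathrm{Mat}_{n\times n}(\mathbb{C}) \oplus \mathbb{C})$ and $\mathbb{P}(\mathrm{Mat}_{(n-1)\times n}(\mathbb{C}) \oplus \mathbb{C})$, where a matrix $A$ is identified with the point $[A:1]$. The linear projection $\mathbb{P}(\mathrm{Mat}_{n\times n}(\mathbb{C})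 \oplus \mathbb{C}) \dashrightarrow \mathbb{P}(\mathrm{Mat}_{(n-1)\times n}(\mathbb{C}) \oplus \mathbb{C})$ that deletes the first row of the matrix is regular on $\overline{\mathrm{SO}(n)}$ (its center does not meet $\overline{\mathrm{SO}(n)}$), maps $\overline{\mathrm{SO}(n)}$ onto $\overline{\mathrm{St}(n-1,n)}$, and is birational between these two varieties. -/

import Mathlib

open MvPolynomial Filter
open scoped LinearAlgebra.Projectivization

namespace StiefelDegree

noncomputable section

/-! ### Degree of an affine variety -/

/-- The affine Hilbert function of `X ⊆ 𝔸^σ`: the dimension of the filtered piece `ℂ[X]_{≤ t}`,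
the image in the coordinate ring `ℂ[X] = ℂ[x_σ] / I_X` of the polynomials of total degree at
most `t`. -/
def hilbertFunction {σ : Type} (X : Set (σ → ℂ)) (t : ℕ) : ℕ :=
  Module.finrank ℂ
    ((restrictTotalDegree σ ℂ t).map
      (Ideal.Quotient.mkₐ ℂ (vanishingIdeal ℂ X)).toLinearMap)

/-- `p` is the Hilbert polynomial of `X`: it agrees with the Hilbert function for large `t`. -/
def IsHilbertPolynomial {σ : Type} (X : Set (σ → ℂ)) (p : Polynomial ℚ) : Prop :=
  ∀ᶠ t : ℕ in atTop, (hilbertFunction X t : ℚ) = p.eval (t : ℚ)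

/-- `X` has degree `d`: it has a Hilbert polynomial, and its leading coefficient is
`d / (dim X)!`, where `dim X` is the degree of the Hilbert polynomial. -/
def HasDegree {σ : Type} (X : Set (σ → ℂ)) (d : ℕ) : Prop :=
  ∃ p : Polynomial ℚ, IsHilbertPolynomial X p ∧
    p.leadingCoeff = (d : ℚ) / (p.natDegree.factorial : ℚ)

/-- The degree is unique. -/
theorem HasDegree.unique {σ : Type} {X : Set (σ → ℂ)} {d e : ℕ}
    (hd : HasDegree X d) (he : HasDegree X e) : d = e := by
  obtain ⟨p, hp, hpd⟩ := hd
  obtain ⟨q, hq, hqe⟩ := he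
  have hpq : p = q := by
    obtain ⟨N, hN⟩ := eventually_atTop.1 (hp.and hq)
    refine Polynomial.eq_of_infinite_eval_eq p q ?_
    refine Set.Infinite.mono ?_ ((Set.Ici_infinite N).image
      (f := fun t : ℕ => (t : ℚ)) Nat.cast_injective.injOn)
    rintro _ ⟨t, ht, rfl⟩
    exact (hN t ht).1.symm.trans (hN t ht).2
  subst hpq
  have h0 : (p.natDegree.factorial : ℚ) ≠ 0 := by
    exact_mod_cast p.natDegree.factorial_ne_zero
  rw [hpd, div_left_inj' h0] at hqe
  exact_mod_cast hqe

/-! ### Projective space, Zariski closure, rational maps -/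

/-- Zariski closure in the projective space with homogeneous coordinates indexed by `τ`: the
common zeros of all homogeneous polynomials vanishing on `S`. -/
def zariskiClosure {τ : Type} (S : Set (ℙ ℂ (τ → ℂ))) : Set (ℙ ℂ (τ → ℂ)) :=
  {P | ∀ (e : ℕ) (F : MvPolynomial τ ℂ), F.IsHomogeneous e →
    (∀ Q ∈ S, eval Q.rep F = 0) → eval P.rep F = 0}

/-- `U` is a Zariski dense, relatively Zariski open subset of `Z`. -/
def IsDenseOpenIn {τ : Type} (U Z : Set (ℙ ℂ (τ → ℂ))) : Prop :=
  U ⊆ Z ∧ Z ⊆ zariskiClosure U ∧ zariskiClosure (Z \ U) ∩ Z ⊆ Z \ U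

/-- The affine chart `x ↦ [1 : x]`; the additional homogeneous coordinate has index `none`. -/
def toProj {σ : Type} (x : σ → ℂ) : ℙ ℂ (Option σ → ℂ) :=
  Projectivization.mk ℂ (fun o => o.elim 1 x) (fun h => one_ne_zero (congrFun h none))

/-- The closure in projective space of a subset of affine space. -/
def projClosure {σ : Type} (X : Set (σ → ℂ)) : Set (ℙ ℂ (Option σ → ℂ)) :=
  zariskiClosure (toProj '' X)

/-- A tuple of homogeneous polynomials of one common degree, presenting a rational map
`P ↦ [F_u(P)]_u` between projective spaces. -/
structure RatMap (τ υ : Type) where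
  /-- the common degree -/
  deg : ℕ
  /-- the coordinates of the map -/
  coord : υ → MvPolynomial τ ℂ
  isHomogeneous : ∀ u, (coord u).IsHomogeneous deg

/-- The partial function given by a tuple of homogeneous polynomials; its domain is the set of
points where the polynomials do not all vanish. -/
def RatMap.toPFun {τ υ : Type} (f : RatMap τ υ) : ℙ ℂ (τ → ℂ) →. ℙ ℂ (υ → ℂ) :=
  fun P => ⟨(fun u => eval P.rep (f.coord u)) ≠ 0, fun h => Projectivization.mk ℂ _ h⟩

/-- `f` restricts to a birational map between `X` and `Y`: there are dense open subsets of `X`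
and `Y` between which `f` and some tuple of homogeneous polynomials are mutually inverse. -/
def RatMap.IsBirationalBetween {τ υ : Type} (f : RatMap τ υ)
    (X : Set (ℙ ℂ (τ → ℂ))) (Y : Set (ℙ ℂ (υ → ℂ))) : Prop :=
  ∃ (g : RatMap υ τ) (U : Set (ℙ ℂ (τ → ℂ))) (V : Set (ℙ ℂ (υ → ℂ))),
    IsDenseOpenIn U X ∧ IsDenseOpenIn V Y ∧
    (∀ P ∈ U, ∃ Q ∈ V, Q ∈ f.toPFun P ∧ P ∈ g.toPFun Q) ∧
    (∀ Q ∈ V, ∃ P ∈ U, P ∈ g.toPFun Q ∧ Q ∈ f.toPFun P)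

/-! ### Stiefel manifolds and special orthogonal groups -/

/-- The affine space of `k × n` matrices, with coordinates the entries. -/
def entries {k n : ℕ} (A : Matrix (Fin k) (Fin n) ℂ) : Fin k × Fin n → ℂ :=
  fun p => A p.1 p.2

/-- The complex Stiefel manifold `St(k,n)` of `k × n` matrices with `A Aᵀ = 1`. -/
def St (k n : ℕ) : Set (Fin k × Fin n → ℂ) :=
  entries '' {A : Matrix (Fin k) (Fin n) ℂ | A * A.transpose = 1}

/-- The complex special orthogonal group `SO(n)`: `A Aᵀ = 1` and `det A = 1`. -/
def SO (n : ℕ) : Set (Fin n × Fin n → ℂ) :=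
  entries '' (Matrix.specialOrthogonalGroup (Fin n) ℂ : Set (Matrix (Fin n) (Fin n) ℂ))

/-- The linear projection `ℙ(Mat_{(n+1) × (n+1)} ⊕ ℂ) ⇢ ℙ(Mat_{n × (n+1)} ⊕ ℂ)` deleting the
first row. -/
def deleteFirstRow (n : ℕ) :
    RatMap (Option (Fin (n + 1) × Fin (n + 1))) (Option (Fin n × Fin (n + 1))) where
  deg := 1
  coord := fun o => X (o.map (Prod.map Fin.succ id))
  isHomogeneous := fun _ => isHomogeneous_X _ _

end

end StiefelDegree

/-!
An element of `SO (n + 1)` has its first row `a` determined by the other rows `B`: since the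
transpose is the adjugate, the entries of `a` are the signed maximal minors of `B`
(`crossRows_eq_of_mul_transpose_eq_one`). Conversely these minors complete every point of
`St n (n + 1)` (`completeFrame_mem_SO`), so deleting the first row is a bijection of affine
varieties whose inverse is polynomial of degree `n`.

The step that controls the behaviour at infinity is that the columns are orthonormal as well, which
expresses every product `a_j a_k` by a quadratic form `gramPoly` in the other homogeneous
coordinates. Hence modulo these relations every form is `f₀ + ∑ j, a_j f_j` with `f₀` and `f_j` free
of the first row (`exists_isReduction`). This has three consequences.

* Degrees. Pulling back functions embeds `ℂ[St]_{≤ t}` into `ℂ[SO]_{≤ t}`, and replacing `a_j` by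
  minors embeds `ℂ[SO]_{≤ t}` into `ℂ[St]_{≤ t + n + 1}`. Two Hilbert functions that interlace up to
  a bounded shift have Hilbert polynomials with the same leading term
  (`natDegree_eq_and_leadingCoeff_eq_of_le_of_le`). That Hilbert polynomials exist at all is proved
  for arbitrary subsets of affine space by homogenizing and by Noetherian induction on homogeneous
  ideals (`eventuallyPolynomial_gradedHilbertFunction`); the leading coefficient is `d / m!` by
  forward differences.
* Regularity. At a point of the center all `a_j ^ 2` vanish, so all coordinates do
  (`IsGram.eq_zero`).
* Surjectivity. Over a point `w` of the closure of the Stiefel manifold the quadratic relations have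
  solutions `(a, w)` and `(-a, w)`. The product of the values of a form at these two points is the
  value of a form at `w` (`exists_norm`), which vanishes if the form vanishes on `SO (n + 1)`; hence
  one of the two points lies in the closure of `SO (n + 1)`
  (`exists_mem_closureCone_comp_lowerIndex_eq`).

Birationality holds on the complements of the hyperplane at infinity, with the inverse given by the
homogenized minors (`completionMap`).
-/

namespace StiefelDegree

/-! ### Eventually polynomial functions -/

/-- The function `f : ℕ → ℚ` agrees with a polynomial for all large arguments. -/
def EventuallyPolynomial (f : ℕ → ℚ) : Prop :=
  ∃ p : Polynomial ℚ, ∀ᶠ t : ℕ in atTop, f t = p.eval (t : ℚ)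

theorem EventuallyPolynomial.add {f g : ℕ → ℚ} (hf : EventuallyPolynomial f)
    (hg : EventuallyPolynomial g) : EventuallyPolynomial fun t => f t + g t := by
  obtain ⟨p, hp⟩ := hf
  obtain ⟨q, hq⟩ := hg
  refine ⟨p + q, ?_⟩
  filter_upwards [hp, hq] with t h1 h2
  rw [h1, h2, Polynomial.eval_add]

theorem EventuallyPolynomial.comp_succ {f : ℕ → ℚ} (hf : EventuallyPolynomial f) :
    EventuallyPolynomial fun t => f (t + 1) := by
  obtain ⟨p, hp⟩ := hf
  refine ⟨p.comp (Polynomial.X + 1), ?_⟩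
  filter_upwards [(tendsto_add_atTop_nat 1).eventually hp] with t ht
  rw [ht]
  simp

theorem EventuallyPolynomial.of_comp_succ {f : ℕ → ℚ}
    (hf : EventuallyPolynomial fun t => f (t + 1)) : EventuallyPolynomial f := by
  obtain ⟨p, hp⟩ := hf
  refine ⟨p.comp (Polynomial.X - 1), ?_⟩
  obtain ⟨N, hN⟩ := eventually_atTop.1 hp
  filter_upwards [eventually_ge_atTop (N + 1)] with t ht
  obtain ⟨s, rfl⟩ : ∃ s, t = s + 1 := ⟨t - 1, by omega⟩
  refine (hN s (by omega)).trans ?_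
  simp

/-- Bernoulli polynomials provide discrete antiderivatives. -/
theorem exists_eval_add_one_sub_eval (q : Polynomial ℚ) :
    ∃ p : Polynomial ℚ, ∀ x : ℚ, p.eval (x + 1) - p.eval x = q.eval x := by
  induction q using Polynomial.induction_on' with
  | add a b ha hb =>
    obtain ⟨p, hp⟩ := ha
    obtain ⟨r, hr⟩ := hb
    refine ⟨p + r, fun x => ?_⟩
    rw [Polynomial.eval_add, Polynomial.eval_add, Polynomial.eval_add, ← hp, ← hr]
    ring
  | monomial k a =>
    refine ⟨Polynomial.C (a / (k + 1)) * Polynomial.bernoulli (k + 1), fun x => ?_⟩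
    have hk : (k + 1 : ℚ) ≠ 0 := by positivity
    rw [add_comm x 1, Polynomial.eval_mul, Polynomial.eval_mul, Polynomial.bernoulli_eval_one_add]
    simp only [Polynomial.eval_C, Nat.cast_add, Nat.cast_one, Nat.add_sub_cancel,
      Polynomial.eval_monomial]
    field_simp
    ring

theorem EventuallyPolynomial.of_sub {f : ℕ → ℚ}
    (hf : EventuallyPolynomial fun t => f (t + 1) - f t) : EventuallyPolynomial f := by
  obtain ⟨q, hq⟩ := hf
  obtain ⟨p, hp⟩ := exists_eval_add_one_sub_eval q
  obtain ⟨N, hN⟩ := eventually_atTop.1 hq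
  refine ⟨p + Polynomial.C (f N - p.eval (N : ℚ)), ?_⟩
  filter_upwards [eventually_ge_atTop N] with t ht
  induction t, ht using Nat.le_induction with
  | base => simp
  | succ t ht ih =>
    have h1 := hN t ht
    have h2 := hp t
    simp only [Polynomial.eval_add, Polynomial.eval_C] at ih ⊢
    push_cast
    linarith

/-- A polynomial with natural number values at large natural numbers has leading coefficient
`d / m!`, where `m` is its degree: `d` is the value of its `m`-th forward difference. -/
theorem exists_leadingCoeff_eq_div_factorial (p : Polynomial ℚ) (f : ℕ → ℕ)
    (hp : ∀ᶠ t : ℕ in atTop, (f t : ℚ) = p.eval (t : ℚ)) :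
    ∃ d : ℕ, p.leadingCoeff = (d : ℚ) / (p.natDegree.factorial : ℚ) := by
  have h0 : (p.natDegree.factorial : ℚ) ≠ 0 := by
    exact_mod_cast p.natDegree.factorial_ne_zero
  obtain ⟨N, hN⟩ := eventually_atTop.1 hp
  have hz : ∃ z : ℤ, p.leadingCoeff * (p.natDegree.factorial : ℚ) = z := by
    have h1 := congrFun p.fwdDiff_iter_degree_eq_factorial (N : ℚ)
    rw [fwdDiff_iter_eq_sum_shift] at h1
    refine ⟨∑ k ∈ Finset.range (p.natDegree + 1),
      ((-1 : ℤ) ^ (p.natDegree - k) * (p.natDegree.choose k)) * (f (N + k) : ℤ), ?_⟩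
    have h2 : (p.leadingCoeff • (p.natDegree.factorial : ℚ → ℚ)) (N : ℚ)
        = p.leadingCoeff * (p.natDegree.factorial : ℚ) := by simp
    rw [← h2, ← h1]
    push_cast
    refine Finset.sum_congr rfl fun k _ => ?_
    rw [hN (N + k) (by omega)]
    simp
  have hnn : 0 ≤ p.leadingCoeff := by
    by_contra! hlt
    rcases Nat.eq_zero_or_pos p.natDegree with hd | hd
    · have h1 := hN N le_rfl
      rw [Polynomial.eq_C_of_natDegree_eq_zero hd, Polynomial.eval_C] at h1
      have h2 : p.leadingCoeff = p.coeff 0 := by rw [Polynomial.leadingCoeff, hd]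
      have h3 : (0 : ℚ) ≤ f N := Nat.cast_nonneg _
      linarith
    · have h1 := (p.tendsto_atBot_of_leadingCoeff_nonpos
        (Polynomial.natDegree_pos_iff_degree_pos.1 hd) hlt.le).comp
        (tendsto_natCast_atTop_atTop (R := ℚ))
      obtain ⟨t, h2, h3⟩ := ((h1.eventually (eventually_lt_atBot 0)).and hp).exists
      have h4 : (0 : ℚ) ≤ f t := Nat.cast_nonneg _
      simp only [Function.comp] at h2
      linarith
  obtain ⟨z, hz⟩ := hz
  have hz0 : 0 ≤ z := by
    have : (0 : ℚ) ≤ z := by rw [← hz]; positivity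
    exact_mod_cast this
  lift z to ℕ using hz0
  exact ⟨z, by rw [eq_div_iff h0, hz]; simp⟩

/-- Polynomials that interlace up to a bounded shift of the argument have the same degree and the
same leading coefficient, since the quotient of `q (t + c)` by `q t` tends to `1`. -/
theorem natDegree_eq_and_leadingCoeff_eq_of_le_of_le {p q : Polynomial ℚ} {c : ℕ}
    (hpos : ∀ᶠ t : ℕ in atTop, 0 < q.eval (t : ℚ))
    (h1 : ∀ᶠ t : ℕ in atTop, q.eval (t : ℚ) ≤ p.eval (t : ℚ))
    (h2 : ∀ᶠ t : ℕ in atTop, p.eval (t : ℚ) ≤ q.eval ((t + c : ℕ) : ℚ)) :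
    p.natDegree = q.natDegree ∧ p.leadingCoeff = q.leadingCoeff := by
  have hq : q ≠ 0 := by
    rintro rfl
    obtain ⟨t, ht⟩ := hpos.exists
    simp at ht
  have hp : p ≠ 0 := by
    rintro rfl
    obtain ⟨t, ht, ht'⟩ := (hpos.and h1).exists
    simp only [Polynomial.eval_zero] at ht'
    linarith
  have hlq : q.leadingCoeff ≠ 0 := Polynomial.leadingCoeff_ne_zero.2 hq
  have hcast := tendsto_natCast_atTop_atTop (R := ℚ)
  set r := q.comp (Polynomial.X + Polynomial.C (c : ℚ)) with hr
  have hrd : r.natDegree = q.natDegree := by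
    rw [hr, Polynomial.natDegree_comp, Polynomial.natDegree_X_add_C, mul_one]
  have hrl : r.leadingCoeff = q.leadingCoeff := by
    rw [hr, Polynomial.leadingCoeff_comp (by rw [Polynomial.natDegree_X_add_C]; exact one_ne_zero),
      Polynomial.leadingCoeff_X_add_C]
    simp
  have hr0 : r ≠ 0 := Polynomial.leadingCoeff_ne_zero.1 (hrl ▸ hlq)
  have hlim : Tendsto (fun t : ℕ => p.eval (t : ℚ) / q.eval (t : ℚ)) atTop (nhds 1) := by
    have h3 := (Polynomial.div_tendsto_atTop_leadingCoeff_div_of_degree_eq r q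
      (by rw [Polynomial.degree_eq_natDegree hr0, Polynomial.degree_eq_natDegree hq, hrd])).comp
        hcast
    rw [hrl, div_self hlq] at h3
    refine tendsto_of_tendsto_of_tendsto_of_le_of_le' tendsto_const_nhds h3 ?_ ?_
    · filter_upwards [hpos, h1] with t ht ht'
      rwa [one_le_div ht]
    · filter_upwards [hpos, h2] with t ht ht'
      simp only [Function.comp, hr, Polynomial.eval_comp, Polynomial.eval_add, Polynomial.eval_X,
        Polynomial.eval_C]
      push_cast at ht'
      gcongr
  have hdeg : p.degree = q.degree := by
    rcases lt_trichotomy p.degree q.degree with h | h | h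
    · exact absurd (tendsto_nhds_unique hlim
        ((Polynomial.div_tendsto_atTop_zero_of_degree_lt p q h).comp hcast)) one_ne_zero
    · exact h
    · have h3 := hlim.inv₀ one_ne_zero
      simp only [inv_div, inv_one] at h3
      exact absurd (tendsto_nhds_unique h3
        ((Polynomial.div_tendsto_atTop_zero_of_degree_lt q p h).comp hcast)) one_ne_zero
  refine ⟨Polynomial.natDegree_eq_of_degree_eq hdeg, ?_⟩
  have h3 := tendsto_nhds_unique hlim
    ((Polynomial.div_tendsto_atTop_leadingCoeff_div_of_degree_eq p q hdeg).comp hcast)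
  rwa [eq_comm, div_eq_one_iff_eq hlq] at h3

/-! ### Hilbert functions of homogeneous ideals -/

section Hilbert

variable {k : Type*} [Field k]

theorem finrank_map_add_finrank_inf_ker {V V' : Type*} [AddCommGroup V] [Module k V]
    [AddCommGroup V'] [Module k V'] (f : V →ₗ[k] V') (W : Submodule k V) [FiniteDimensional k W] :
    Module.finrank k (W.map f) + Module.finrank k (W ⊓ LinearMap.ker f : Submodule k V) =
      Module.finrank k W := by
  have h := (f.domRestrict W).finrank_range_add_finrank_ker
  rw [LinearMap.range_domRestrict, LinearMap.ker_domRestrict] at h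
  rw [← h, ← Submodule.map_comap_subtype,
    Submodule.finrank_map_subtype_eq]

theorem finrank_map_eq_finrank_map {V V₁ V₂ : Type*} [AddCommGroup V] [Module k V]
    [AddCommGroup V₁] [Module k V₁] [AddCommGroup V₂] [Module k V₂] (f : V →ₗ[k] V₁)
    (g : V →ₗ[k] V₂) (W : Submodule k V) [FiniteDimensional k W]
    (h : ∀ v ∈ W, f v = 0 ↔ g v = 0) :
    Module.finrank k (W.map f) = Module.finrank k (W.map g) := by
  have h1 := finrank_map_add_finrank_inf_ker f W
  have h2 := finrank_map_add_finrank_inf_ker g W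
  have h3 : W ⊓ LinearMap.ker f = W ⊓ LinearMap.ker g := by
    ext v
    simp only [Submodule.mem_inf, LinearMap.mem_ker]
    exact and_congr_right fun hv => h v hv
  rw [h3] at h1
  omega

variable {σ : Type*}

instance [Finite σ] (t : ℕ) : FiniteDimensional k (homogeneousSubmodule σ k t) :=
  Module.Finite.of_fg (homogeneousSubmodule_fg σ k t)

theorem homogeneousComponent_X_mul (i : σ) (p : MvPolynomial σ k) (n : ℕ) :
    homogeneousComponent (n + 1) (X i * p) = X i * homogeneousComponent n p := by
  induction p using MvPolynomial.induction_on' with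
  | monomial m a =>
    have h1 : (monomial m a).IsHomogeneous m.degree := isHomogeneous_monomial a rfl
    rw [homogeneousComponent_of_mem h1,
      homogeneousComponent_of_mem (((isHomogeneous_X k i).mul h1 :))]
    by_cases h : n = m.degree
    · rw [if_pos h, if_pos (by omega)]
    · rw [if_neg h, if_neg (by omega), mul_zero]
  | add p q hp hq => rw [mul_add, map_add, map_add, hp, hq, mul_add]

theorem homogeneousComponent_zero_X_mul (i : σ) (p : MvPolynomial σ k) :
    homogeneousComponent 0 (X i * p) = 0 := by
  rw [homogeneousComponent_zero, ← constantCoeff_eq, map_mul, constantCoeff_X, zero_mul, map_zero]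

/-- The ideal `J` is homogeneous: it contains the homogeneous components of its elements. -/
def IsHomogeneousIdeal (J : Ideal (MvPolynomial σ k)) : Prop :=
  ∀ p ∈ J, ∀ n, homogeneousComponent n p ∈ J

/-- The colon ideal `J : x_i`. -/
noncomputable def colonX (J : Ideal (MvPolynomial σ k)) (i : σ) : Ideal (MvPolynomial σ k) :=
  Submodule.comap (LinearMap.mulLeft (MvPolynomial σ k) (X i)) J

theorem mem_colonX {J : Ideal (MvPolynomial σ k)} {i : σ} {p : MvPolynomial σ k} :
    p ∈ colonX J i ↔ X i * p ∈ J := Iff.rfl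

theorem IsHomogeneousIdeal.colonX {J : Ideal (MvPolynomial σ k)} (hJ : IsHomogeneousIdeal J)
    (i : σ) : IsHomogeneousIdeal (colonX J i) := by
  intro p hp n
  rw [mem_colonX, ← homogeneousComponent_X_mul]
  exact hJ _ hp _

theorem mem_sup_span_X {J : Ideal (MvPolynomial σ k)} {i : σ} {p : MvPolynomial σ k} :
    p ∈ J ⊔ Ideal.span {X i} ↔ ∃ q ∈ J, ∃ r, q + X i * r = p := by
  simp only [Submodule.mem_sup, Ideal.mem_span_singleton']
  constructor
  · rintro ⟨q, hq, _, ⟨r, rfl⟩, rfl⟩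
    exact ⟨q, hq, r, by ring⟩
  · rintro ⟨q, hq, r, rfl⟩
    exact ⟨q, hq, _, ⟨r, rfl⟩, by ring⟩

theorem IsHomogeneousIdeal.sup_span_X {J : Ideal (MvPolynomial σ k)} (hJ : IsHomogeneousIdeal J)
    (i : σ) : IsHomogeneousIdeal (J ⊔ Ideal.span {X i}) := by
  intro p hp n
  obtain ⟨q, hq, r, rfl⟩ := mem_sup_span_X.1 hp
  rw [map_add]
  cases n with
  | zero =>
    rw [homogeneousComponent_zero_X_mul, add_zero]
    exact Ideal.mem_sup_left (hJ q hq 0)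
  | succ n =>
    rw [homogeneousComponent_X_mul]
    exact mem_sup_span_X.2 ⟨_, hJ q hq _, _, rfl⟩

/-- The Hilbert function of the quotient by `J`: the dimension of the space of classes of
homogeneous polynomials of degree `t`. -/
noncomputable def gradedHilbertFunction (J : Ideal (MvPolynomial σ k)) (t : ℕ) : ℕ :=
  Module.finrank k ((homogeneousSubmodule σ k t).map (Ideal.Quotient.mkₐ k J).toLinearMap)

/-- The dimension count in the exact sequence
`0 → (S / (J : x)) (-1) → S / J → S / (J + (x)) → 0`. -/
theorem gradedHilbertFunction_succ [Finite σ] {J : Ideal (MvPolynomial σ k)}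
    (hJ : IsHomogeneousIdeal J) (i : σ) (t : ℕ) :
    gradedHilbertFunction J (t + 1) =
      gradedHilbertFunction (colonX J i) t +
        gradedHilbertFunction (J ⊔ Ideal.span {X i}) (t + 1) := by
  set W := (homogeneousSubmodule σ k (t + 1)).map (Ideal.Quotient.mkₐ k J).toLinearMap with hW
  have hle : J ≤ J ⊔ Ideal.span {X i} := le_sup_left
  set f := (Ideal.Quotient.factorₐ k hle).toLinearMap with hf
  have h1 := finrank_map_add_finrank_inf_ker f W
  have h2 : W.map f = (homogeneousSubmodule σ k (t + 1)).map
      (Ideal.Quotient.mkₐ k (J ⊔ Ideal.span {X i})).toLinearMap := by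
    rw [hW, ← Submodule.map_comp]
    congr 1
  have h3 : W ⊓ LinearMap.ker f = (homogeneousSubmodule σ k t).map
      ((Ideal.Quotient.mkₐ k J).toLinearMap ∘ₗ LinearMap.mulLeft k (X i)) := by
    ext w
    simp only [hW, Submodule.mem_inf, Submodule.mem_map, LinearMap.mem_ker]
    constructor
    · rintro ⟨⟨p, hp, rfl⟩, hw⟩
      have hp' : p ∈ J ⊔ Ideal.span {X i} := Ideal.Quotient.eq_zero_iff_mem.1 hw
      obtain ⟨q, hq, r, hqr⟩ := mem_sup_span_X.1 hp'
      refine ⟨homogeneousComponent t r, homogeneousComponent_mem _ _, ?_⟩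
      refine Ideal.Quotient.eq.2 ?_
      have h4 : p = homogeneousComponent (t + 1) q + X i * homogeneousComponent t r := by
        rw [← homogeneousComponent_X_mul, ← map_add, hqr, homogeneousComponent_eq_self hp]
      rw [LinearMap.mulLeft_apply]
      have h5 : X i * homogeneousComponent t r - p = -homogeneousComponent (t + 1) q := by
        rw [h4]; ring
      rw [h5]
      exact neg_mem (hJ q hq _)
    · rintro ⟨r, hr, rfl⟩
      refine ⟨⟨X i * r, ?_, rfl⟩, ?_⟩
      · rw [add_comm]
        exact (isHomogeneous_X k i).mul hr
      · exact Ideal.Quotient.eq_zero_iff_mem.2 (mem_sup_span_X.2 ⟨0, J.zero_mem, r, zero_add _⟩)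
  have h4 : Module.finrank k ((homogeneousSubmodule σ k t).map
      ((Ideal.Quotient.mkₐ k J).toLinearMap ∘ₗ LinearMap.mulLeft k (X i))) =
        gradedHilbertFunction (colonX J i) t := by
    refine finrank_map_eq_finrank_map _ _ _ fun v _ => ?_
    exact Ideal.Quotient.eq_zero_iff_mem.trans
      (mem_colonX.symm.trans Ideal.Quotient.eq_zero_iff_mem.symm)
  rw [h2, h3, h4] at h1
  rw [gradedHilbertFunction, ← h1, add_comm]
  rfl

/-- Hilbert's theorem on the Hilbert function of a homogeneous ideal `J`, by Noetherian induction: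
if some variable `x` is not in `J`, then `J + (x)` is larger than `J`; the colon ideal `J : x` is
larger as well, or equal to `J`, and then the Hilbert function of `J + (x)` is the difference of
that of `J`. -/
theorem eventuallyPolynomial_gradedHilbertFunction [Finite σ] (J : Ideal (MvPolynomial σ k))
    (hJ : IsHomogeneousIdeal J) :
    EventuallyPolynomial fun t => (gradedHilbertFunction J t : ℚ) := by
  induction J using WellFoundedGT.induction with
  | ind J ih =>
  by_cases hX : ∀ i : σ, X i ∈ J
  · refine ⟨0, ?_⟩
    filter_upwards [eventually_ge_atTop 1] with t ht
    have h0 : (homogeneousSubmodule σ k t).map (Ideal.Quotient.mkₐ k J).toLinearMap = ⊥ := by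
      rw [eq_bot_iff, Submodule.map_le_iff_le_comap]
      intro p hp
      refine Ideal.Quotient.eq_zero_iff_mem.2 ?_
      have h1 : Ideal.span (X '' Set.univ : Set (MvPolynomial σ k)) ≤ J := by
        rw [Ideal.span_le]
        rintro _ ⟨i, -, rfl⟩
        exact hX i
      refine h1 (mem_ideal_span_X_image.2 fun m hm => ?_)
      have h2 : m.degree = t := by
        by_contra h
        exact (mem_support_iff.1 hm) (hp.coeff_eq_zero h)
      by_contra! h3
      have h4 : m = 0 := Finsupp.ext fun i => h3 i (Set.mem_univ i)
      rw [h4, map_zero] at h2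
      omega
    simp [gradedHilbertFunction, h0]
  · push Not at hX
    obtain ⟨i, hi⟩ := hX
    have h1 : J < J ⊔ Ideal.span {X i} := by
      refine lt_of_le_of_ne le_sup_left fun h => hi ?_
      rw [h]
      exact Ideal.mem_sup_right (Ideal.mem_span_singleton_self _)
    have h2 := (ih _ h1 (hJ.sup_span_X i)).comp_succ
    have h3 : J ≤ colonX J i := fun p hp => J.mul_mem_left _ hp
    rcases h3.eq_or_lt with h4 | h4
    · refine EventuallyPolynomial.of_sub ?_
      convert h2 using 2 with t
      rw [gradedHilbertFunction_succ hJ i t, ← h4]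
      push_cast
      ring
    · refine EventuallyPolynomial.of_comp_succ ?_
      convert (ih _ h4 (hJ.colonX i)).add h2 using 2 with t
      rw [gradedHilbertFunction_succ hJ i t]
      push_cast
      rfl

end Hilbert

/-! ### Homogenization -/

section Homogenize

variable {σ : Type}

/-- The vector `(1, x)` of homogeneous coordinates of the point of projective space that
corresponds to the point `x` of affine space. -/
def homogCoord (x : σ → ℂ) : Option σ → ℂ := fun o => o.elim 1 x

@[simp] theorem homogCoord_none (x : σ → ℂ) : homogCoord x none = 1 := rfl

@[simp] theorem homogCoord_some (x : σ → ℂ) (i : σ) : homogCoord x (some i) = x i := rfl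

/-- The homogenization of `p` in degree `t`, for polynomials `p` of degree at most `t`. -/
noncomputable def homogenization (t : ℕ) (p : MvPolynomial σ ℂ) : MvPolynomial (Option σ) ℂ :=
  ∑ i ∈ Finset.range (t + 1), X none ^ (t - i) * rename some (homogeneousComponent i p)

theorem isHomogeneous_homogenization (t : ℕ) (p : MvPolynomial σ ℂ) :
    (homogenization t p).IsHomogeneous t := by
  refine IsHomogeneous.sum _ _ _ fun i hi => ?_
  have h1 : i ≤ t := Nat.lt_succ_iff.1 (Finset.mem_range.1 hi)
  have h2 := (isHomogeneous_X_pow (R := ℂ) (none : Option σ) (t - i)).mul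
    ((homogeneousComponent_isHomogeneous i p).rename_isHomogeneous (f := some))
  rwa [Nat.sub_add_cancel h1] at h2

theorem eval_homogenization {t : ℕ} {p : MvPolynomial σ ℂ} (hp : p.totalDegree ≤ t)
    (x : σ → ℂ) : eval (homogCoord x) (homogenization t p) = eval x p := by
  have h1 : ∑ i ∈ Finset.range (t + 1), homogeneousComponent i p = p := by
    rw [← Finset.sum_subset (Finset.range_mono (Nat.succ_le_succ hp)) fun i _ hi =>
      homogeneousComponent_eq_zero i p (by simpa using hi)]
    exact sum_homogeneousComponent p
  conv_rhs => rw [← h1]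
  rw [homogenization, map_sum, map_sum]
  refine Finset.sum_congr rfl fun i _ => ?_
  rw [map_mul, map_pow, eval_X, homogCoord_none, one_pow, one_mul, eval_rename]
  rfl

/-- Setting the additional homogeneous coordinate equal to `1`. -/
noncomputable def dehomogenization : MvPolynomial (Option σ) ℂ →ₐ[ℂ] MvPolynomial σ ℂ :=
  aeval fun o => o.elim 1 X

theorem eval_dehomogenization (F : MvPolynomial (Option σ) ℂ) (x : σ → ℂ) :
    eval x (dehomogenization F) = eval (homogCoord x) F := by
  rw [dehomogenization, ← coe_aeval_eq_eval, ← coe_aeval_eq_eval, RingHom.coe_coe, RingHom.coe_coe,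
    ← AlgHom.comp_apply, comp_aeval]
  congr 2
  funext o
  cases o <;> simp

theorem totalDegree_dehomogenization_le (F : MvPolynomial (Option σ) ℂ) :
    (dehomogenization F).totalDegree ≤ F.totalDegree := by
  rw [dehomogenization, aeval_def, eval₂_eq]
  refine totalDegree_finsetSum_le fun m hm => ?_
  refine (totalDegree_mul _ _).trans ?_
  rw [algebraMap_eq, totalDegree_C, zero_add]
  refine (totalDegree_finsetProd _ _).trans ?_
  refine le_trans (Finset.sum_le_sum fun o _ => ?_) (le_totalDegree hm)
  refine (totalDegree_pow _ _).trans ?_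
  cases o with
  | none => simp
  | some i => simp

end Homogenize

/-! ### Hilbert polynomials of affine varieties -/

section Degree

variable {σ τ : Type}

/-- Restriction of polynomials to functions on the set `Y`. -/
noncomputable def restrictFun (Y : Set (σ → ℂ)) : MvPolynomial σ ℂ →ₗ[ℂ] (Y → ℂ) where
  toFun p x := eval x.1 p
  map_add' p q := by ext x; simp
  map_smul' c p := by ext x; simp

theorem restrictFun_eq_zero_iff {Y : Set (σ → ℂ)} {p : MvPolynomial σ ℂ} :
    restrictFun Y p = 0 ↔ p ∈ vanishingIdeal ℂ Y :=
  ⟨fun h x hx => congrFun h ⟨x, hx⟩, fun h => funext fun x => h x.1 x.2⟩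

theorem hilbertFunction_eq_finrank_map_restrictFun [Finite σ] (Y : Set (σ → ℂ)) (t : ℕ) :
    hilbertFunction Y t =
      Module.finrank ℂ ((restrictTotalDegree σ ℂ t).map (restrictFun Y)) :=
  finrank_map_eq_finrank_map _ _ _ fun _ _ =>
    Ideal.Quotient.eq_zero_iff_mem.trans restrictFun_eq_zero_iff.symm

/-- The Hilbert function does not increase along a surjective map `φ : Y → Z` if every polynomial
of degree at most `t` on `Z` pulls back to a polynomial of degree at most `s` on `Y`. -/
theorem hilbertFunction_le_of_surjOn [Finite σ] [Finite τ] {Y : Set (σ → ℂ)} {Z : Set (τ → ℂ)}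
    (φ : (σ → ℂ) → τ → ℂ) (hmaps : Set.MapsTo φ Y Z) (hsurj : Set.SurjOn φ Y Z) {t s : ℕ}
    (h : ∀ p : MvPolynomial τ ℂ, p.totalDegree ≤ t →
      ∃ q : MvPolynomial σ ℂ, q.totalDegree ≤ s ∧ ∀ x ∈ Y, eval (φ x) p = eval x q) :
    hilbertFunction Z t ≤ hilbertFunction Y s := by
  rw [hilbertFunction_eq_finrank_map_restrictFun, hilbertFunction_eq_finrank_map_restrictFun]
  let f : (Z → ℂ) →ₗ[ℂ] (Y → ℂ) := LinearMap.funLeft ℂ ℂ (hmaps.restrict φ Y Z)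
  have hf : Function.Injective f := LinearMap.funLeft_injective_of_surjective _ _ _
    ((Set.MapsTo.restrict_surjective_iff hmaps).2 hsurj)
  rw [(Submodule.equivMapOfInjective f hf _).finrank_eq]
  refine Submodule.finrank_mono ?_
  rintro _ ⟨_, ⟨p, hp, rfl⟩, rfl⟩
  obtain ⟨q, hq, hpq⟩ := h p ((mem_restrictTotalDegree _ _ _).1 hp)
  exact ⟨q, (mem_restrictTotalDegree _ _ _).2 hq, funext fun x => (hpq x.1 x.2).symm⟩

theorem hilbertFunction_pos [Finite σ] {Y : Set (σ → ℂ)} (hY : Y.Nonempty) (t : ℕ) :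
    0 < hilbertFunction Y t := by
  rw [hilbertFunction_eq_finrank_map_restrictFun, Module.finrank_pos_iff_exists_ne_zero]
  refine ⟨⟨restrictFun Y 1, 1, (mem_restrictTotalDegree _ _ _).2 (by simp), rfl⟩, fun h => ?_⟩
  obtain ⟨y, hy⟩ := hY
  have h1 := congrFun (congrArg Subtype.val h) ⟨y, hy⟩
  simp [restrictFun] at h1

attribute [local instance] MvPolynomial.gradedAlgebra in
/-- The affine Hilbert function of `Y` is the Hilbert function of the ideal of its projective
closure, which is the largest homogeneous ideal in the vanishing ideal of the points `(1, x)`. -/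
theorem exists_hilbertFunction_eq_gradedHilbertFunction [Finite σ] (Y : Set (σ → ℂ)) :
    ∃ J : Ideal (MvPolynomial (Option σ) ℂ), IsHomogeneousIdeal J ∧
      ∀ t, hilbertFunction Y t = gradedHilbertFunction J t := by
  set A := vanishingIdeal ℂ (homogCoord '' Y) with hA
  set J := A.homogeneousCore (homogeneousSubmodule (Option σ) ℂ) with hJ
  refine ⟨J.toIdeal, fun p hp n => homogeneousComponent_mem_of_mem J.isHomogeneous hp n,
    fun t => ?_⟩
  let g : MvPolynomial (Option σ) ℂ →ₗ[ℂ] (Y → ℂ) :=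
    restrictFun Y ∘ₗ dehomogenization.toLinearMap
  have h1 : (restrictTotalDegree σ ℂ t).map (restrictFun Y) =
      (homogeneousSubmodule (Option σ) ℂ t).map g := by
    apply le_antisymm
    · rintro _ ⟨p, hp, rfl⟩
      refine ⟨homogenization t p, isHomogeneous_homogenization t p, funext fun x => ?_⟩
      exact (eval_dehomogenization _ _).trans
        (eval_homogenization ((mem_restrictTotalDegree _ _ _).1 hp) _)
    · rintro _ ⟨F, hF, rfl⟩
      exact ⟨dehomogenization F, (mem_restrictTotalDegree _ _ _).2
        ((totalDegree_dehomogenization_le F).trans (IsHomogeneous.totalDegree_le hF)), rfl⟩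
  rw [hilbertFunction_eq_finrank_map_restrictFun, h1]
  refine finrank_map_eq_finrank_map _ _ _ fun F hF => ?_
  have h2 : g F = 0 ↔ F ∈ A := by
    rw [hA, mem_vanishingIdeal_iff, Set.forall_mem_image]
    exact ⟨fun h x hx => (eval_dehomogenization F x).symm.trans (congrFun h ⟨x, hx⟩),
      fun h => funext fun x => (eval_dehomogenization F x.1).trans (h x.2)⟩
  refine h2.trans (Iff.trans ?_ Ideal.Quotient.eq_zero_iff_mem.symm)
  exact ⟨fun h => Ideal.mem_homogeneousCore_of_homogeneous_of_mem ⟨t, hF⟩ h,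
    fun h => Ideal.toIdeal_homogeneousCore_le _ A h⟩

theorem exists_hasDegree [Finite σ] (Y : Set (σ → ℂ)) : ∃ d, HasDegree Y d := by
  obtain ⟨J, hJ, h⟩ := exists_hilbertFunction_eq_gradedHilbertFunction Y
  obtain ⟨p, hp⟩ := eventuallyPolynomial_gradedHilbertFunction J hJ
  have hp' : IsHilbertPolynomial Y p := hp.mono fun t ht => by
    rw [h]
    exact ht
  obtain ⟨d, hd⟩ := exists_leadingCoeff_eq_div_factorial p _ hp'
  exact ⟨d, p, hp', hd⟩

/-- Sets whose Hilbert functions interlace up to a bounded shift have the same degree. -/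
theorem HasDegree.of_hilbertFunction_le [Finite σ] [Finite τ] {Y : Set (σ → ℂ)} {Z : Set (τ → ℂ)}
    {d c : ℕ} (hd : HasDegree Y d) (hZ : Z.Nonempty)
    (h1 : ∀ t, hilbertFunction Z t ≤ hilbertFunction Y t)
    (h2 : ∀ t, hilbertFunction Y t ≤ hilbertFunction Z (t + c)) : HasDegree Z d := by
  obtain ⟨p, hp, hpd⟩ := hd
  obtain ⟨e, q, hq, -⟩ := exists_hasDegree Z
  obtain ⟨h3, h4⟩ := natDegree_eq_and_leadingCoeff_eq_of_le_of_le (p := p) (q := q) (c := c)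
    (hq.mono fun t ht => by rw [← ht]; exact_mod_cast hilbertFunction_pos hZ t)
    ((hq.and hp).mono fun t ht => by rw [← ht.1, ← ht.2]; exact_mod_cast h1 t)
    ((hp.and ((tendsto_add_atTop_nat c).eventually hq)).mono fun t ht => by
      rw [← ht.1, ← ht.2]; exact_mod_cast h2 t)
  exact ⟨q, hq, by rw [← h3, ← h4, hpd]⟩

end Degree

/-! ### Completing an orthonormal `n`-frame to a special orthogonal matrix -/

section Matrices

open Matrix

variable {R : Type*} {n : ℕ}

/-- The matrix with first row `u` and remaining rows `B`. -/
def addFirstRow (u : Fin (n + 1) → R) (B : Matrix (Fin n) (Fin (n + 1)) R) :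
    Matrix (Fin (n + 1)) (Fin (n + 1)) R :=
  Matrix.of (Fin.cons u B)

@[simp] theorem addFirstRow_zero (u : Fin (n + 1) → R) (B : Matrix (Fin n) (Fin (n + 1)) R) (j) :
    addFirstRow u B 0 j = u j := rfl

variable [CommRing R]

/-- The generalized cross product of the rows of `B`: the vector of signed maximal minors. -/
def crossRows (B : Matrix (Fin n) (Fin (n + 1)) R) (j : Fin (n + 1)) : R :=
  (-1) ^ (j : ℕ) * (B.submatrix id j.succAbove).det

theorem det_addFirstRow (u : Fin (n + 1) → R) (B : Matrix (Fin n) (Fin (n + 1)) R) :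
    (addFirstRow u B).det = crossRows B ⬝ᵥ u := by
  rw [det_succ_row_zero]
  refine Finset.sum_congr rfl fun j _ => ?_
  rw [crossRows, addFirstRow_zero, mul_right_comm]
  rfl

theorem mulVec_crossRows (B : Matrix (Fin n) (Fin (n + 1)) R) : B *ᵥ crossRows B = 0 := by
  funext i
  rw [Matrix.mulVec, dotProduct_comm, ← det_addFirstRow]
  exact det_zero_of_row_eq (Fin.succ_ne_zero i).symm rfl

theorem addFirstRow_mul_transpose {B : Matrix (Fin n) (Fin (n + 1)) R} (hB : B * Bᵀ = 1)
    {u v : Fin (n + 1) → R} (hu : B *ᵥ u = 0) (hv : B *ᵥ v = 0) :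
    addFirstRow u B * (addFirstRow v B)ᵀ = diagonal (Fin.cons (u ⬝ᵥ v) 1) := by
  ext i j
  refine Fin.cases ?_ (fun i => ?_) i <;> refine Fin.cases ?_ (fun j => ?_) j
  · rfl
  · rw [diagonal_apply_ne _ (Fin.succ_ne_zero j).symm]
    exact (dotProduct_comm _ _).trans (congrFun hu j)
  · rw [diagonal_apply_ne _ (Fin.succ_ne_zero i)]
    exact congrFun hv i
  · have h := congrFun (congrFun hB i) j
    rw [one_apply] at h
    rw [diagonal_apply]
    simp only [Fin.succ_inj, Fin.cons_succ, Pi.one_apply]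
    exact h

theorem det_addFirstRow_mul_det_addFirstRow {B : Matrix (Fin n) (Fin (n + 1)) R} (hB : B * Bᵀ = 1)
    {u v : Fin (n + 1) → R} (hu : B *ᵥ u = 0) (hv : B *ᵥ v = 0) :
    (addFirstRow u B).det * (addFirstRow v B).det = u ⬝ᵥ v := by
  rw [← det_transpose (addFirstRow v B), ← det_mul, addFirstRow_mul_transpose hB hu hv,
    det_diagonal, Fin.prod_univ_succ]
  simp

/-- The projection `1 - Bᵀ * B` to the orthogonal complement of the rows has trace `1`. Hence one
of its columns is not isotropic. -/
theorem exists_mulVec_eq_zero_dotProduct_self_ne_zero [Nontrivial R]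
    {B : Matrix (Fin n) (Fin (n + 1)) R}
    (hB : B * Bᵀ = 1) : ∃ u : Fin (n + 1) → R, B *ᵥ u = 0 ∧ u ⬝ᵥ u ≠ 0 := by
  set P : Matrix (Fin (n + 1)) (Fin (n + 1)) R := 1 - Bᵀ * B with hP
  have htr : P.trace = 1 := by
    rw [hP, trace_sub, trace_mul_comm, hB, trace_one, trace_one]
    simp
  have hBP : B * P = 0 := by
    rw [hP, Matrix.mul_sub, Matrix.mul_one, ← Matrix.mul_assoc, hB, Matrix.one_mul, sub_self]
  have hPP : Pᵀ * P = P := by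
    have hT : Pᵀ = P := by
      rw [hP, transpose_sub, transpose_one, transpose_mul, transpose_transpose]
    have h : P * P = P - Bᵀ * (B * P) := by
      conv_lhs => rw [hP]
      rw [sub_mul, one_mul, Matrix.mul_assoc, ← hP]
    rw [hT, h, hBP, Matrix.mul_zero, sub_zero]
  obtain ⟨j, hj⟩ : ∃ j, P j j ≠ 0 := by
    by_contra! h
    refine one_ne_zero (α := R) ?_
    rw [← htr]
    exact Finset.sum_eq_zero fun j _ => h j
  refine ⟨fun i => P i j, funext fun i => congrFun (congrFun hBP i) j, ?_⟩
  have h : (fun i => P i j) ⬝ᵥ (fun i => P i j) = P j j := congrFun (congrFun hPP j) j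
  rwa [h]

theorem crossRows_dotProduct_self [IsDomain R] {B : Matrix (Fin n) (Fin (n + 1)) R}
    (hB : B * Bᵀ = 1) : crossRows B ⬝ᵥ crossRows B = 1 := by
  obtain ⟨u, hu, huu⟩ := exists_mulVec_eq_zero_dotProduct_self_ne_zero hB
  have h1 := det_addFirstRow_mul_det_addFirstRow hB hu hu
  have h2 := det_addFirstRow_mul_det_addFirstRow hB (mulVec_crossRows B) hu
  have h3 : (addFirstRow u B).det ≠ 0 := by
    intro h
    rw [h, zero_mul] at h1
    exact huu h1.symm
  rw [← det_addFirstRow u B] at h2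
  rw [← det_addFirstRow]
  exact mul_right_cancel₀ h3 (h2.trans (one_mul _).symm)

/-- The transpose of a special orthogonal matrix is its adjugate. -/
theorem crossRows_eq_of_mul_transpose_eq_one {A : Matrix (Fin (n + 1)) (Fin (n + 1)) R}
    (hA : A * Aᵀ = 1) (hdet : A.det = 1) (j : Fin (n + 1)) :
    crossRows (A.submatrix Fin.succ id) j = A 0 j := by
  have h1 : Aᵀ * A = 1 := mul_eq_one_comm.1 hA
  have h2 : A.adjugate = Aᵀ := by
    rw [← Matrix.one_mul A.adjugate, ← h1, Matrix.mul_assoc, mul_adjugate, hdet, one_smul,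
      Matrix.mul_one]
  have h3 := congrFun (congrFun h2 j) 0
  rw [adjugate_fin_succ_eq_det_submatrix] at h3
  rw [← transpose_apply A, ← h3, crossRows]
  simp [Fin.succAbove_zero]

end Matrices

section Variety

variable {n : ℕ}

theorem mem_St_iff {k : ℕ} {w : Fin k × Fin n → ℂ} :
    w ∈ St k n ↔ (Matrix.of fun i j => w (i, j)) * (Matrix.of fun i j => w (i, j)).transpose = 1 :=
  ⟨by rintro ⟨A, hA, rfl⟩; exact hA, fun h => ⟨_, h, rfl⟩⟩

theorem mem_SO_iff {x : Fin n × Fin n → ℂ} :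
    x ∈ SO n ↔ (Matrix.of fun i j => x (i, j)) * (Matrix.of fun i j => x (i, j)).transpose = 1 ∧
      (Matrix.of fun i j => x (i, j)).det = 1 := by
  constructor
  · rintro ⟨A, hA, rfl⟩
    have h := Matrix.mem_specialOrthogonalGroup_iff.1 hA
    exact ⟨(Matrix.mem_orthogonalGroup_iff (Fin n) ℂ).1 h.1, h.2⟩
  · rintro ⟨h1, h2⟩
    exact ⟨_, Matrix.mem_specialOrthogonalGroup_iff.2
      ⟨(Matrix.mem_orthogonalGroup_iff (Fin n) ℂ).2 h1, h2⟩, rfl⟩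

/-- The entries outside the first row. -/
def lowerEntries (x : Fin (n + 1) × Fin (n + 1) → ℂ) : Fin n × Fin (n + 1) → ℂ :=
  fun p => x (p.1.succ, p.2)

/-- The signed maximal minors of the generic `n × (n + 1)` matrix, as polynomials. -/
noncomputable def minorPoly (n : ℕ) (j : Fin (n + 1)) : MvPolynomial (Fin n × Fin (n + 1)) ℂ :=
  crossRows (Matrix.of fun i c => X (i, c)) j

theorem eval_minorPoly (w : Fin n × Fin (n + 1) → ℂ) (j : Fin (n + 1)) :
    eval w (minorPoly n j) = crossRows (Matrix.of fun i c => w (i, c)) j := by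
  rw [minorPoly, crossRows, crossRows, map_mul, map_pow, map_neg, map_one, RingHom.map_det]
  congr 2
  ext i c
  simp

theorem isHomogeneous_det {σ : Type*} {M : Matrix (Fin n) (Fin n) (MvPolynomial σ ℂ)}
    (hM : ∀ i j, (M i j).IsHomogeneous 1) : M.det.IsHomogeneous n := by
  rw [Matrix.det_apply]
  refine IsHomogeneous.sum _ _ _ fun s _ => ?_
  have h : (∏ i, M (s i) i).IsHomogeneous n := by
    simpa using IsHomogeneous.prod Finset.univ (fun i => M (s i) i) (fun _ => 1)
      (fun i _ => hM (s i) i)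
  rcases Int.units_eq_one_or (Equiv.Perm.sign s) with hs | hs <;> rw [hs]
  · simpa using h
  · simpa using h.neg

theorem isHomogeneous_minorPoly (j : Fin (n + 1)) : (minorPoly n j).IsHomogeneous n := by
  have h := isHomogeneous_det (M := (Matrix.of fun i c =>
    (X (i, c) : MvPolynomial (Fin n × Fin (n + 1)) ℂ)).submatrix id j.succAbove)
    (fun _ _ => isHomogeneous_X _ _)
  rw [minorPoly, crossRows]
  rcases neg_one_pow_eq_or (MvPolynomial (Fin n × Fin (n + 1)) ℂ) (j : ℕ) with hj | hj <;> rw [hj]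
  · simpa using h
  · simpa using h.neg

/-- The completion of an orthonormal frame to a special orthogonal matrix: the inverse of
`lowerEntries` on `SO (n + 1)`. -/
noncomputable def completeFrame (w : Fin n × Fin (n + 1) → ℂ) : Fin (n + 1) × Fin (n + 1) → ℂ :=
  fun p => addFirstRow (fun j => eval w (minorPoly n j)) (Matrix.of fun i c => w (i, c)) p.1 p.2

theorem completeFrame_zero (w : Fin n × Fin (n + 1) → ℂ) (j : Fin (n + 1)) :
    completeFrame w (0, j) = eval w (minorPoly n j) := rfl

theorem lowerEntries_completeFrame (w : Fin n × Fin (n + 1) → ℂ) :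
    lowerEntries (completeFrame w) = w := rfl

theorem completeFrame_mem_SO {w : Fin n × Fin (n + 1) → ℂ} (hw : w ∈ St n (n + 1)) :
    completeFrame w ∈ SO (n + 1) := by
  rw [mem_St_iff] at hw
  set B : Matrix (Fin n) (Fin (n + 1)) ℂ := Matrix.of fun i c => w (i, c) with hB
  have h1 : (Matrix.of fun i j => completeFrame w (i, j)) = addFirstRow (crossRows B) B := by
    have h2 : (fun j => eval w (minorPoly n j)) = crossRows B := funext (eval_minorPoly w)
    rw [← h2]
    rfl
  have h3 := mulVec_crossRows B
  rw [mem_SO_iff, h1, addFirstRow_mul_transpose hw h3 h3, det_addFirstRow,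
    crossRows_dotProduct_self hw]
  refine ⟨?_, rfl⟩
  rw [← Matrix.diagonal_one]
  congr 1
  funext i
  refine Fin.cases rfl (fun i => rfl) i

theorem eval_minorPoly_lowerEntries {x : Fin (n + 1) × Fin (n + 1) → ℂ} (hx : x ∈ SO (n + 1))
    (j : Fin (n + 1)) : eval (lowerEntries x) (minorPoly n j) = x (0, j) := by
  rw [mem_SO_iff] at hx
  rw [eval_minorPoly]
  exact crossRows_eq_of_mul_transpose_eq_one hx.1 hx.2 j

theorem lowerEntries_mem_St {x : Fin (n + 1) × Fin (n + 1) → ℂ} (hx : x ∈ SO (n + 1)) :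
    lowerEntries x ∈ St n (n + 1) := by
  rw [mem_SO_iff] at hx
  rw [mem_St_iff]
  ext i j
  have h := congrFun (congrFun hx.1 i.succ) j.succ
  rw [Matrix.one_apply] at h ⊢
  simp only [Fin.succ_inj] at h
  exact h

theorem SO_nonempty (n : ℕ) : (SO n).Nonempty :=
  ⟨_, 1, one_mem _, rfl⟩

theorem St_nonempty (n : ℕ) : (St n (n + 1)).Nonempty :=
  (SO_nonempty (n + 1)).imp' lowerEntries fun _ => lowerEntries_mem_St

/-- The orthogonality relations between columns, which express the products of entries of the
first row in terms of the other rows: `a_j a_k = δ_jk h² - ∑ i, b_ij b_ik`, where `h` is the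
additional homogeneous coordinate. -/
noncomputable def gramPoly (n : ℕ) (j k : Fin (n + 1)) :
    MvPolynomial (Option (Fin n × Fin (n + 1))) ℂ :=
  C (if j = k then 1 else 0) * X none ^ 2 - ∑ i, X (some (i, j)) * X (some (i, k))

theorem isHomogeneous_gramPoly (j k : Fin (n + 1)) : (gramPoly n j k).IsHomogeneous 2 :=
  (isHomogeneous_C_mul_X_pow _ _ 2).sub
    (IsHomogeneous.sum _ _ _ fun _ _ => (isHomogeneous_X _ _).mul (isHomogeneous_X _ _))

theorem mul_eq_eval_gramPoly {x : Fin (n + 1) × Fin (n + 1) → ℂ} (hx : x ∈ SO (n + 1))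
    (j k : Fin (n + 1)) :
    x (0, j) * x (0, k) = eval (homogCoord (lowerEntries x)) (gramPoly n j k) := by
  rw [mem_SO_iff] at hx
  have h0 := mul_eq_one_comm.1 hx.1
  have h := congrFun (congrFun h0 j) k
  rw [Matrix.mul_apply, Fin.sum_univ_succ, Matrix.one_apply] at h
  simp only [Matrix.transpose_apply, Matrix.of_apply] at h
  simp only [gramPoly, map_sub, map_mul, map_sum, eval_C, eval_X, map_pow, homogCoord_none,
    homogCoord_some, lowerEntries]
  rw [← h]
  ring

end Variety

/-! ### Eliminating the products of entries of the first row -/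

section Elimination

variable {n : ℕ}

/-- The inclusion of the homogeneous coordinates other than those of the first row. -/
def lowerIndex (n : ℕ) : Option (Fin n × Fin (n + 1)) → Option (Fin (n + 1) × Fin (n + 1)) :=
  Option.map (Prod.map Fin.succ id)

theorem homogCoord_comp_lowerIndex (x : Fin (n + 1) × Fin (n + 1) → ℂ) :
    homogCoord x ∘ lowerIndex n = homogCoord (lowerEntries x) := by
  funext o
  cases o <;> rfl

theorem eq_lowerIndex_or_eq_firstRow (u : Option (Fin (n + 1) × Fin (n + 1))) :
    (∃ v, u = lowerIndex n v) ∨ ∃ k, u = some (0, k) := by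
  rcases u with _ | ⟨i, c⟩
  · exact Or.inl ⟨none, rfl⟩
  · refine Fin.cases ?_ (fun i => ?_) i
    · exact Or.inr ⟨c, rfl⟩
    · exact Or.inl ⟨some (i, c), rfl⟩

/-- The vector `z` of homogeneous coordinates satisfies the homogenized orthogonality relations
between columns. -/
def IsGram (z : Option (Fin (n + 1) × Fin (n + 1)) → ℂ) : Prop :=
  ∀ j k, z (some (0, j)) * z (some (0, k)) = eval (z ∘ lowerIndex n) (gramPoly n j k)

theorem isGram_homogCoord {x : Fin (n + 1) × Fin (n + 1) → ℂ} (hx : x ∈ SO (n + 1)) :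
    IsGram (homogCoord x) := by
  intro j k
  rw [homogCoord_comp_lowerIndex]
  exact mul_eq_eval_gramPoly hx j k

/-- The quadratic relations have no nonzero solution in the center of the projection. -/
theorem IsGram.eq_zero {z : Option (Fin (n + 1) × Fin (n + 1)) → ℂ} (hz : IsGram z)
    (h : z ∘ lowerIndex n = 0) : z = 0 := by
  funext u
  rcases eq_lowerIndex_or_eq_firstRow u with ⟨v, rfl⟩ | ⟨k, rfl⟩
  · exact congrFun h v
  · have h1 := hz k k
    rw [h] at h1
    have h2 : eval (0 : Option (Fin n × Fin (n + 1)) → ℂ) (gramPoly n k k) = 0 := by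
      simp [gramPoly]
    rw [h2] at h1
    exact mul_self_eq_zero.1 h1

/-- Modulo the relations `IsGram`, the polynomial `F` is the affine linear expression
`f₀ + ∑ j, a_j f_j` in the entries `a_j` of the first row. -/
def IsReduction (F : MvPolynomial (Option (Fin (n + 1) × Fin (n + 1))) ℂ)
    (f₀ : MvPolynomial (Option (Fin n × Fin (n + 1))) ℂ)
    (f : Fin (n + 1) → MvPolynomial (Option (Fin n × Fin (n + 1))) ℂ) : Prop :=
  ∀ z : Option (Fin (n + 1) × Fin (n + 1)) → ℂ, IsGram z →
    eval z F = eval (z ∘ lowerIndex n) f₀ +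
      ∑ j, z (some (0, j)) * eval (z ∘ lowerIndex n) (f j)

theorem exists_eq_single_add_of_degree_eq_succ {ι : Type*} {m : ι →₀ ℕ} {e : ℕ}
    (hm : m.degree = e + 1) : ∃ u m', m = Finsupp.single u 1 + m' ∧ m'.degree = e := by
  obtain ⟨u, hu⟩ : ∃ u, m u ≠ 0 := by
    by_contra! h
    have h1 : m = 0 := Finsupp.ext h
    rw [h1, map_zero] at hm
    omega
  obtain ⟨m', rfl⟩ : ∃ m', m = Finsupp.single u 1 + m' :=
    exists_add_of_le (Finsupp.single_le_iff.2 (Nat.one_le_iff_ne_zero.2 hu))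
  rw [map_add, Finsupp.degree_single] at hm
  exact ⟨u, m', rfl, by omega⟩

theorem exists_isReduction_monomial (a : ℂ) (e : ℕ)
    (m : Option (Fin (n + 1) × Fin (n + 1)) →₀ ℕ) (hm : m.degree = e + 1) :
    ∃ f₀ f, f₀.IsHomogeneous (e + 1) ∧ (∀ j, (f j).IsHomogeneous e) ∧
      IsReduction (n := n) (monomial m a) f₀ f := by
  classical
  induction e generalizing m with
  | zero =>
    obtain ⟨u, m', rfl, hm'⟩ := exists_eq_single_add_of_degree_eq_succ hm
    rw [Finsupp.degree_eq_zero_iff] at hm'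
    subst hm'
    rw [add_zero]
    have hu : ∀ z : Option (Fin (n + 1) × Fin (n + 1)) → ℂ,
        eval z (monomial (Finsupp.single u 1) a) = a * z u := by
      intro z
      simp [eval_monomial]
    rcases eq_lowerIndex_or_eq_firstRow u with ⟨v, rfl⟩ | ⟨k, rfl⟩
    · refine ⟨C a * X v, 0, isHomogeneous_C_mul_X a v, fun _ => isHomogeneous_zero _ _ _,
        fun z _ => ?_⟩
      rw [hu]
      simp
    · refine ⟨0, Pi.single k (C a), isHomogeneous_zero _ _ _, fun j => ?_, fun z _ => ?_⟩
      · by_cases hj : j = k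
        · subst hj
          rw [Pi.single_eq_same]
          exact isHomogeneous_C _ a
        · rw [Pi.single_eq_of_ne hj]
          exact isHomogeneous_zero _ _ _
      · rw [hu, Finset.sum_eq_single k]
        · simp [mul_comm]
        · intro j _ hj
          simp [Pi.single_eq_of_ne hj]
        · simp
  | succ e ih =>
    obtain ⟨u, m', rfl, hm'⟩ := exists_eq_single_add_of_degree_eq_succ hm
    obtain ⟨f₀, f, h₀, hf, hred⟩ := ih m' hm'
    have hX : ∀ z : Option (Fin (n + 1) × Fin (n + 1)) → ℂ,
        eval z (monomial (Finsupp.single u 1 + m') a) = z u * eval z (monomial m' a) := by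
      intro z
      rw [add_comm (Finsupp.single u 1), monomial_add_single, pow_one, map_mul, eval_X, mul_comm]
    rcases eq_lowerIndex_or_eq_firstRow u with ⟨v, rfl⟩ | ⟨k, rfl⟩
    · refine ⟨X v * f₀, fun j => X v * f j, ?_, fun j => ?_, fun z hz => ?_⟩
      · rw [add_comm (e + 1)]
        exact (isHomogeneous_X _ _).mul h₀
      · rw [add_comm e]
        exact (isHomogeneous_X _ _).mul (hf j)
      · rw [hX, hred z hz, map_mul, eval_X, mul_add, Finset.mul_sum]
        congr 1
        refine Finset.sum_congr rfl fun j _ => ?_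
        rw [map_mul, eval_X, Function.comp_apply]
        ring
    · refine ⟨∑ j, gramPoly n k j * f j, Pi.single k f₀, ?_, fun j => ?_, fun z hz => ?_⟩
      · refine IsHomogeneous.sum _ _ _ fun j _ => ?_
        rw [show e + 1 + 1 = 2 + e by ring]
        exact (isHomogeneous_gramPoly k j).mul (hf j)
      · by_cases hj : j = k
        · subst hj
          rwa [Pi.single_eq_same]
        · rw [Pi.single_eq_of_ne hj]
          exact isHomogeneous_zero _ _ _
      · have hk : ∑ j, z (some (0, j)) * eval (z ∘ lowerIndex n) ((Pi.single k f₀ :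
            Fin (n + 1) → MvPolynomial (Option (Fin n × Fin (n + 1))) ℂ) j) =
              z (some (0, k)) * eval (z ∘ lowerIndex n) f₀ := by
          rw [Finset.sum_eq_single k, Pi.single_eq_same]
          · intro j _ hj
            simp [Pi.single_eq_of_ne hj]
          · simp
        rw [hX, hred z hz, hk, mul_add, Finset.mul_sum, map_sum, add_comm]
        congr 1
        refine Finset.sum_congr rfl fun j _ => ?_
        rw [map_mul, ← hz, mul_assoc]

theorem exists_isReduction {e : ℕ} {F : MvPolynomial (Option (Fin (n + 1) × Fin (n + 1))) ℂ}
    (hF : F.IsHomogeneous (e + 1)) :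
    ∃ f₀ f, f₀.IsHomogeneous (e + 1) ∧ (∀ j, (f j).IsHomogeneous e) ∧ IsReduction F f₀ f := by
  have h : ∀ m : F.support, ∃ f₀ f, f₀.IsHomogeneous (e + 1) ∧ (∀ j, (f j).IsHomogeneous e) ∧
      IsReduction (n := n) (monomial m.1 (F.coeff m)) f₀ f := fun m => by
    refine exists_isReduction_monomial _ e m.1 ?_
    by_contra hd
    exact mem_support_iff.1 m.2 (hF.coeff_eq_zero hd)
  choose f₀ f h₀ hf hred using h
  refine ⟨∑ m, f₀ m, fun j => ∑ m, f m j, IsHomogeneous.sum _ _ _ fun m _ => h₀ m,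
    fun j => IsHomogeneous.sum _ _ _ fun m _ => hf m j, fun z hz => ?_⟩
  conv_lhs => rw [F.as_sum, ← Finset.sum_coe_sort, map_sum]
  rw [map_sum]
  simp_rw [map_sum, Finset.mul_sum]
  rw [Finset.sum_comm, ← Finset.sum_add_distrib]
  exact Finset.sum_congr rfl fun m _ => hred m z hz

/-- Changing the sign of the entries of the first row. -/
def flipFirstRow (z : Option (Fin (n + 1) × Fin (n + 1)) → ℂ) :
    Option (Fin (n + 1) × Fin (n + 1)) → ℂ :=
  fun o => o.elim (z none) fun p => if p.1 = 0 then -z (some p) else z (some p)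

theorem flipFirstRow_firstRow (z : Option (Fin (n + 1) × Fin (n + 1)) → ℂ) (j : Fin (n + 1)) :
    flipFirstRow z (some (0, j)) = -z (some (0, j)) := rfl

theorem flipFirstRow_comp_lowerIndex (z : Option (Fin (n + 1) × Fin (n + 1)) → ℂ) :
    flipFirstRow z ∘ lowerIndex n = z ∘ lowerIndex n := by
  funext o
  cases o with
  | none => rfl
  | some p => simp [flipFirstRow, lowerIndex, Fin.succ_ne_zero]

theorem IsGram.flipFirstRow {z : Option (Fin (n + 1) × Fin (n + 1)) → ℂ} (hz : IsGram z) :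
    IsGram (flipFirstRow z) := by
  intro j k
  rw [flipFirstRow_firstRow, flipFirstRow_firstRow, flipFirstRow_comp_lowerIndex, neg_mul_neg]
  exact hz j k

/-- The norm of `F` with respect to the sign change of the first row, as a polynomial in the other
homogeneous coordinates. -/
theorem exists_norm {e : ℕ} {F : MvPolynomial (Option (Fin (n + 1) × Fin (n + 1))) ℂ}
    (hF : F.IsHomogeneous (e + 1)) :
    ∃ N : MvPolynomial (Option (Fin n × Fin (n + 1))) ℂ, N.IsHomogeneous (2 * (e + 1)) ∧
      ∀ z, IsGram z → eval z F * eval (flipFirstRow z) F = eval (z ∘ lowerIndex n) N := by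
  obtain ⟨f₀, f, h₀, hf, hred⟩ := exists_isReduction hF
  refine ⟨f₀ * f₀ - ∑ j, ∑ k, gramPoly n j k * (f j * f k), ?_, fun z hz => ?_⟩
  · refine IsHomogeneous.sub ?_ ?_
    · rw [two_mul]
      exact h₀.mul h₀
    · refine IsHomogeneous.sum _ _ _ fun j _ => IsHomogeneous.sum _ _ _ fun k _ => ?_
      rw [show 2 * (e + 1) = 2 + (e + e) by ring]
      exact (isHomogeneous_gramPoly j k).mul ((hf j).mul (hf k))
  · have h1 : ∑ j, ∑ k, eval (z ∘ lowerIndex n) (gramPoly n j k * (f j * f k)) =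
        (∑ j, z (some (0, j)) * eval (z ∘ lowerIndex n) (f j)) *
          ∑ k, z (some (0, k)) * eval (z ∘ lowerIndex n) (f k) := by
      rw [Finset.sum_mul_sum]
      refine Finset.sum_congr rfl fun j _ => Finset.sum_congr rfl fun k _ => ?_
      rw [map_mul, map_mul, ← hz j k]
      ring
    rw [hred z hz, hred _ hz.flipFirstRow, flipFirstRow_comp_lowerIndex]
    simp only [flipFirstRow_firstRow, neg_mul, Finset.sum_neg_distrib, map_sub, map_sum]
    rw [h1, map_mul]
    ring

end Elimination

/-! ### Equality of the degrees -/

section DegreeEq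

variable {n : ℕ}

theorem hilbertFunction_St_le_SO (n t : ℕ) :
    hilbertFunction (St n (n + 1)) t ≤ hilbertFunction (SO (n + 1)) t :=
  hilbertFunction_le_of_surjOn lowerEntries (fun _ => lowerEntries_mem_St)
    (fun w hw => ⟨completeFrame w, completeFrame_mem_SO hw, lowerEntries_completeFrame w⟩)
    fun p hp => ⟨rename (Prod.map Fin.succ id) p, (totalDegree_rename_le _ _).trans hp,
      fun _ _ => (eval_rename _ _ _).symm⟩

theorem completeFrame_lowerEntries {x : Fin (n + 1) × Fin (n + 1) → ℂ} (hx : x ∈ SO (n + 1)) :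
    completeFrame (lowerEntries x) = x := by
  funext ⟨i, j⟩
  refine Fin.cases ?_ (fun i => rfl) i
  rw [completeFrame_zero, eval_minorPoly_lowerEntries hx]

/-- A polynomial on `SO (n + 1)` is `f₀ + ∑ j, a_j f_j`, and on the Stiefel manifold the entry
`a_j` of the first row is a minor of size `n`. -/
theorem hilbertFunction_SO_le_St (n t : ℕ) :
    hilbertFunction (SO (n + 1)) t ≤ hilbertFunction (St n (n + 1)) (t + (n + 1)) := by
  refine hilbertFunction_le_of_surjOn completeFrame (fun _ => completeFrame_mem_SO)
    (fun x hx => ⟨lowerEntries x, lowerEntries_mem_St hx, completeFrame_lowerEntries hx⟩)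
    fun p hp => ?_
  obtain ⟨f₀, f, h₀, hf, hred⟩ := exists_isReduction (isHomogeneous_homogenization (t + 1) p)
  refine ⟨dehomogenization f₀ + ∑ j, minorPoly n j * dehomogenization (f j), ?_, fun w hw => ?_⟩
  · refine (totalDegree_add _ _).trans (max_le ?_ (totalDegree_finsetSum_le fun j _ => ?_))
    · have h1 := (totalDegree_dehomogenization_le f₀).trans h₀.totalDegree_le
      omega
    · refine (totalDegree_mul _ _).trans ?_
      have h1 := (totalDegree_dehomogenization_le (f j)).trans (hf j).totalDegree_le
      have h2 := (isHomogeneous_minorPoly j).totalDegree_le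
      omega
  · rw [← eval_homogenization (hp.trans (Nat.le_succ t)),
      hred _ (isGram_homogCoord (completeFrame_mem_SO hw)), homogCoord_comp_lowerIndex,
      lowerEntries_completeFrame, map_add, map_sum, eval_dehomogenization]
    congr 1
    refine Finset.sum_congr rfl fun j _ => ?_
    rw [map_mul, eval_dehomogenization, homogCoord_some, completeFrame_zero]

end DegreeEq

/-! ### Projective closures and rational maps in homogeneous coordinates -/

section Projective

variable {σ τ υ : Type}

theorem eval_smul_of_isHomogeneous {F : MvPolynomial τ ℂ} {e : ℕ} (hF : F.IsHomogeneous e) (c : ℂ)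
    (v : τ → ℂ) : eval (c • v) F = c ^ e * eval v F := by
  rw [eval_eq, eval_eq, Finset.mul_sum]
  refine Finset.sum_congr rfl fun m hm => ?_
  have hd : ∑ i ∈ m.support, m i = e := by
    rw [← Finsupp.degree_apply]
    by_contra h
    exact mem_support_iff.1 hm (hF.coeff_eq_zero h)
  simp only [Pi.smul_apply, smul_eq_mul, mul_pow, Finset.prod_mul_distrib,
    Finset.prod_pow_eq_pow_sum, hd]
  ring

theorem eval_rep_mk_eq_zero_iff {F : MvPolynomial τ ℂ} {e : ℕ} (hF : F.IsHomogeneous e) {v : τ → ℂ}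
    (hv : v ≠ 0) : eval (Projectivization.mk ℂ v hv).rep F = 0 ↔ eval v F = 0 := by
  obtain ⟨a, ha⟩ := Projectivization.exists_smul_eq_mk_rep ℂ v hv
  rw [← ha, Units.smul_def, eval_smul_of_isHomogeneous hF]
  simp

/-- The affine cone over the projective closure of `Y`. -/
def closureCone (Y : Set (σ → ℂ)) : Set (Option σ → ℂ) :=
  {z | ∀ (e : ℕ) (F : MvPolynomial (Option σ) ℂ), F.IsHomogeneous e →
    (∀ y ∈ Y, eval (homogCoord y) F = 0) → eval z F = 0}

theorem homogCoord_ne_zero (y : σ → ℂ) : homogCoord y ≠ 0 :=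
  fun h => one_ne_zero (congrFun h none)

theorem mem_projClosure_iff {Y : Set (σ → ℂ)} {P : ℙ ℂ (Option σ → ℂ)} :
    P ∈ projClosure Y ↔ P.rep ∈ closureCone Y := by
  refine forall₃_congr fun e F hF => ?_
  rw [Set.forall_mem_image]
  exact imp_congr_left (forall₂_congr fun y _ => eval_rep_mk_eq_zero_iff hF (homogCoord_ne_zero y))

theorem mk_mem_projClosure_iff {Y : Set (σ → ℂ)} {z : Option σ → ℂ} (hz : z ≠ 0) :
    Projectivization.mk ℂ z hz ∈ projClosure Y ↔ z ∈ closureCone Y := by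
  rw [mem_projClosure_iff]
  exact forall₃_congr fun e F hF => imp_congr_right fun _ => eval_rep_mk_eq_zero_iff hF hz

theorem homogCoord_mem_closureCone {Y : Set (σ → ℂ)} {y : σ → ℂ} (hy : y ∈ Y) :
    homogCoord y ∈ closureCone Y := fun _ _ _ h => h y hy

theorem rep_mk_none_ne_zero_iff {z : Option σ → ℂ} (hz : z ≠ 0) :
    (Projectivization.mk ℂ z hz).rep none ≠ 0 ↔ z none ≠ 0 := by
  have h := eval_rep_mk_eq_zero_iff (isHomogeneous_X ℂ (none : Option σ)) hz
  rw [eval_X, eval_X] at h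
  exact not_congr h

/-- The part of the projective closure outside the hyperplane at infinity is dense and open. -/
theorem isDenseOpenIn_projClosure (Y : Set (σ → ℂ)) :
    IsDenseOpenIn {P ∈ projClosure Y | P.rep none ≠ 0} (projClosure Y) := by
  refine ⟨fun P hP => hP.1, fun P hP e F hF h => hP e F hF ?_, fun P hP => ⟨hP.2, fun h => h.2 ?_⟩⟩
  · rintro _ ⟨y, hy, rfl⟩
    refine h _ ⟨(mk_mem_projClosure_iff (homogCoord_ne_zero y)).2
      (homogCoord_mem_closureCone hy), ?_⟩
    exact (rep_mk_none_ne_zero_iff (homogCoord_ne_zero y)).2 one_ne_zero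
  · have h1 := hP.1 1 (X none) (isHomogeneous_X _ _) fun Q hQ => by
      rw [eval_X]
      by_contra h0
      exact hQ.2 ⟨hQ.1, h0⟩
    rwa [eval_X] at h1

theorem RatMap.mk_mem_toPFun_iff (f : RatMap τ υ) {P : ℙ ℂ (τ → ℂ)} {y : υ → ℂ} (hy : y ≠ 0) :
    Projectivization.mk ℂ y hy ∈ f.toPFun P ↔
      ∃ c : ℂ, c ≠ 0 ∧ ∀ u, eval P.rep (f.coord u) = c * y u := by
  constructor
  · rintro ⟨h1, h2⟩
    obtain ⟨a, ha⟩ := (Projectivization.mk_eq_mk_iff ℂ _ _ h1 hy).1 h2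
    exact ⟨a, a.ne_zero, fun u => (congrFun ha u).symm⟩
  · rintro ⟨c, hc, h⟩
    have h0 : (fun u => eval P.rep (f.coord u)) = c • y := funext h
    have h1 : (fun u => eval P.rep (f.coord u)) ≠ 0 := by
      rw [h0]
      exact smul_ne_zero hc hy
    exact ⟨h1, (Projectivization.mk_eq_mk_iff' ℂ _ _ h1 hy).2 ⟨c, h0.symm⟩⟩

theorem RatMap.mem_toPFun_mk_iff (f : RatMap τ υ) {z : τ → ℂ} (hz : z ≠ 0) {Q : ℙ ℂ (υ → ℂ)} :
    Q ∈ f.toPFun (Projectivization.mk ℂ z hz) ↔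
      ∃ c : ℂ, c ≠ 0 ∧ ∀ u, eval z (f.coord u) = c * Q.rep u := by
  obtain ⟨a, ha⟩ := Projectivization.exists_smul_eq_mk_rep ℂ z hz
  have ha0 : (a : ℂ) ^ f.deg ≠ 0 := pow_ne_zero _ a.ne_zero
  conv_lhs => rw [← Q.mk_rep]
  rw [f.mk_mem_toPFun_iff Q.rep_nonzero, ← ha]
  simp_rw [Units.smul_def, eval_smul_of_isHomogeneous (f.isHomogeneous _)]
  constructor
  · rintro ⟨c, hc, h⟩
    refine ⟨c / (a : ℂ) ^ f.deg, div_ne_zero hc ha0, fun u => ?_⟩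
    rw [div_mul_eq_mul_div, ← h u, mul_div_cancel_left₀ _ ha0]
  · rintro ⟨c, hc, h⟩
    refine ⟨(a : ℂ) ^ f.deg * c, mul_ne_zero ha0 hc, fun u => ?_⟩
    rw [h u, mul_assoc]

end Projective

/-! ### Lifting points of the closure of the Stiefel manifold -/

section Lift

variable {n : ℕ}

theorem isGram_of_mem_closureCone {z : Option (Fin (n + 1) × Fin (n + 1)) → ℂ}
    (hz : z ∈ closureCone (SO (n + 1))) : IsGram z := by
  intro j k
  have h1 : ∀ v : Option (Fin (n + 1) × Fin (n + 1)) → ℂ,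
      eval v (X (some (0, j)) * X (some (0, k)) - rename (lowerIndex n) (gramPoly n j k)) =
        v (some (0, j)) * v (some (0, k)) - eval (v ∘ lowerIndex n) (gramPoly n j k) := by
    intro v
    rw [map_sub, map_mul, eval_X, eval_X, eval_rename]
  have h2 := hz 2 (X (some (0, j)) * X (some (0, k)) - rename (lowerIndex n) (gramPoly n j k))
    (((isHomogeneous_X _ _).mul (isHomogeneous_X _ _)).sub
      (isHomogeneous_gramPoly j k).rename_isHomogeneous)
    fun x hx => by rw [h1, isGram_homogCoord hx j k, sub_self]
  rw [h1] at h2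
  exact sub_eq_zero.1 h2

theorem comp_lowerIndex_mem_closureCone {z : Option (Fin (n + 1) × Fin (n + 1)) → ℂ}
    (hz : z ∈ closureCone (SO (n + 1))) : z ∘ lowerIndex n ∈ closureCone (St n (n + 1)) := by
  intro e F hF h
  rw [← eval_rename]
  refine hz e _ hF.rename_isHomogeneous fun x hx => ?_
  rw [eval_rename, homogCoord_comp_lowerIndex]
  exact h _ (lowerEntries_mem_St hx)

/-- The entries of the first row are minors of the other rows. -/
theorem eval_minorPoly_mul_of_mem_closureCone {z : Option (Fin (n + 1) × Fin (n + 1)) → ℂ}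
    (hz : z ∈ closureCone (SO (n + 1))) (j : Fin (n + 1)) :
    eval (z ∘ lowerIndex n) (rename some (minorPoly n j)) * z none =
      z none ^ n * z (some (0, j)) := by
  have h1 : ∀ v : Option (Fin (n + 1) × Fin (n + 1)) → ℂ,
      eval v (rename (lowerIndex n) (rename some (minorPoly n j)) * X none -
        X none ^ n * X (some (0, j))) =
      eval (v ∘ lowerIndex n) (rename some (minorPoly n j)) * v none -
        v none ^ n * v (some (0, j)) := by
    intro v
    rw [map_sub, map_mul, map_mul, map_pow, eval_X, eval_X, eval_rename]
  have h2 := hz (n + 1) (rename (lowerIndex n) (rename some (minorPoly n j)) * X none -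
        X none ^ n * X (some (0, j)))
    ((((isHomogeneous_minorPoly j).rename_isHomogeneous.rename_isHomogeneous).mul
      (isHomogeneous_X _ _)).sub ((isHomogeneous_X_pow _ _).mul (isHomogeneous_X _ _)))
    fun x hx => by
      have h3 : homogCoord (lowerEntries x) ∘ some = lowerEntries x := rfl
      rw [h1, homogCoord_comp_lowerIndex, eval_rename, h3, eval_minorPoly_lowerEntries hx,
        homogCoord_none, homogCoord_some]
      ring
  rw [h1] at h2
  exact sub_eq_zero.1 h2

/-- A matrix `M` whose entries satisfy `M_jk M_lm = M_jl M_km` is symmetric of rank at most one: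
it is of the form `a aᵀ`. -/
theorem exists_mul_eq_of_mul_eq_mul {ι : Type*} (M : ι → ι → ℂ)
    (hM : ∀ j k l m, M j k * M l m = M j l * M k m) : ∃ a : ι → ℂ, ∀ j k, a j * a k = M j k := by
  by_cases h : ∃ j, M j j ≠ 0
  · obtain ⟨j, hj⟩ := h
    obtain ⟨s, hs⟩ := IsAlgClosed.exists_eq_mul_self (M j j)
    refine ⟨fun k => M j k / s, fun k l => ?_⟩
    have h1 := hM j j k l
    rw [div_mul_div_comm, ← hs, ← h1, mul_div_cancel_left₀ _ hj]
  · push Not at h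
    refine ⟨0, fun j k => ?_⟩
    have h1 := hM j k j k
    rw [h j, zero_mul] at h1
    rw [mul_self_eq_zero.1 h1, Pi.zero_apply, zero_mul]

/-- On the closure of the Stiefel manifold the quadratic relations for the first row are
solvable. -/
theorem exists_isGram_of_mem_closureCone {w : Option (Fin n × Fin (n + 1)) → ℂ}
    (hw : w ∈ closureCone (St n (n + 1))) : ∃ z, IsGram z ∧ z ∘ lowerIndex n = w := by
  obtain ⟨a, ha⟩ := exists_mul_eq_of_mul_eq_mul (fun j k => eval w (gramPoly n j k))
    fun j k l m => by
      have h1 := hw 4 (gramPoly n j k * gramPoly n l m - gramPoly n j l * gramPoly n k m)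
        (((isHomogeneous_gramPoly _ _).mul (isHomogeneous_gramPoly _ _)).sub
          ((isHomogeneous_gramPoly _ _).mul (isHomogeneous_gramPoly _ _)))
        fun y hy => by
          have h2 := mul_eq_eval_gramPoly (completeFrame_mem_SO hy)
          rw [lowerEntries_completeFrame] at h2
          rw [map_sub, map_mul, map_mul, ← h2, ← h2, ← h2, ← h2]
          ring
      rw [map_sub, map_mul, map_mul] at h1
      exact sub_eq_zero.1 h1
  let z : Option (Fin (n + 1) × Fin (n + 1)) → ℂ := fun o => o.elim (w none) fun p =>
    (Fin.cons (a p.2) fun i => w (some (i, p.2)) : Fin (n + 1) → ℂ) p.1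
  have hz : z ∘ lowerIndex n = w := by
    funext o
    cases o <;> rfl
  exact ⟨z, fun j k => by rw [hz]; exact ha j k, hz⟩

/-- Suppose that both solutions `z` and `z'` of the quadratic relations over `w` are outside the
cone over the closure of `SO (n + 1)`, and let `F₁`, `F₂` be forms of one degree that vanish on
`SO (n + 1)` but not at `z`, respectively `z'`. Since their norms vanish at `w`, each of them is
zero at the other solution, so the norm of `F₁ + F₂` does not vanish at `w`, a contradiction. -/
theorem exists_mem_closureCone_comp_lowerIndex_eq {w : Option (Fin n × Fin (n + 1)) → ℂ}
    (hw : w ∈ closureCone (St n (n + 1))) (hw0 : w ≠ 0) :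
    ∃ z ∈ closureCone (SO (n + 1)), z ∘ lowerIndex n = w := by
  obtain ⟨z, hz, hzw⟩ := exists_isGram_of_mem_closureCone hw
  by_contra! hcon
  have h1 : z ∉ closureCone (SO (n + 1)) := fun h => hcon z h hzw
  have h2 : flipFirstRow z ∉ closureCone (SO (n + 1)) := fun h =>
    hcon _ h ((flipFirstRow_comp_lowerIndex z).trans hzw)
  have hnorm : ∀ (e : ℕ) (F : MvPolynomial (Option (Fin (n + 1) × Fin (n + 1))) ℂ),
      F.IsHomogeneous (e + 1) → (∀ x ∈ SO (n + 1), eval (homogCoord x) F = 0) →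
        eval z F * eval (flipFirstRow z) F = 0 := by
    intro e F hF hF0
    obtain ⟨N, hN, hN'⟩ := exists_norm hF
    rw [hN' z hz, hzw]
    refine hw _ N hN fun y hy => ?_
    have h3 := completeFrame_mem_SO hy
    have h4 := hN' _ (isGram_homogCoord h3)
    rw [homogCoord_comp_lowerIndex, lowerEntries_completeFrame, hF0 _ h3, zero_mul] at h4
    exact h4.symm
  simp only [closureCone, Set.mem_ofPred_eq, not_forall] at h1 h2
  obtain ⟨e₁, F₁, hF₁, hF₁0, hne₁⟩ := h1
  obtain ⟨e₂, F₂, hF₂, hF₂0, hne₂⟩ := h2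
  obtain ⟨u, hu⟩ := Function.ne_iff.1 hw0
  have hzu : z (lowerIndex n u) = w u := congrFun hzw u
  have hzu' : flipFirstRow z (lowerIndex n u) = w u :=
    (congrFun (flipFirstRow_comp_lowerIndex z) u).trans hzu
  -- Powers of a coordinate that does not vanish at `w` bring the two polynomials to one degree.
  set G₁ := X (lowerIndex n u) ^ (e₂ + 1) * F₁ with hG₁
  set G₂ := X (lowerIndex n u) ^ (e₁ + 1) * F₂ with hG₂
  have hd₁ : G₁.IsHomogeneous (e₁ + e₂ + 1) := by
    rw [show e₁ + e₂ + 1 = (e₂ + 1) + e₁ by ring]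
    exact (isHomogeneous_X_pow _ _).mul hF₁
  have hd₂ : G₂.IsHomogeneous (e₁ + e₂ + 1) := by
    rw [show e₁ + e₂ + 1 = (e₁ + 1) + e₂ by ring]
    exact (isHomogeneous_X_pow _ _).mul hF₂
  have hG₁0 : ∀ x ∈ SO (n + 1), eval (homogCoord x) G₁ = 0 := fun x hx => by
    rw [hG₁, map_mul, hF₁0 x hx, mul_zero]
  have hG₂0 : ∀ x ∈ SO (n + 1), eval (homogCoord x) G₂ = 0 := fun x hx => by
    rw [hG₂, map_mul, hF₂0 x hx, mul_zero]
  have hn₁ : eval z G₁ ≠ 0 := by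
    rw [hG₁, map_mul, map_pow, eval_X, hzu]
    exact mul_ne_zero (pow_ne_zero _ hu) hne₁
  have hn₂ : eval (flipFirstRow z) G₂ ≠ 0 := by
    rw [hG₂, map_mul, map_pow, eval_X, hzu']
    exact mul_ne_zero (pow_ne_zero _ hu) hne₂
  have hz₁ := (mul_eq_zero.1 (hnorm _ _ hd₁ hG₁0)).resolve_left hn₁
  have hz₂ := (mul_eq_zero.1 (hnorm _ _ hd₂ hG₂0)).resolve_right hn₂
  have h3 := hnorm _ _ (hd₁.add hd₂) fun x hx => by rw [map_add, hG₁0 x hx, hG₂0 x hx, add_zero]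
  rw [map_add, map_add, hz₁, hz₂, add_zero, zero_add] at h3
  exact mul_ne_zero hn₁ hn₂ h3

end Lift

/-! ### The projection deleting the first row -/

section Projection

variable {n : ℕ}

theorem eval_deleteFirstRow_coord (z : Option (Fin (n + 1) × Fin (n + 1)) → ℂ)
    (v : Option (Fin n × Fin (n + 1))) :
    eval z ((deleteFirstRow n).coord v) = (z ∘ lowerIndex n) v := eval_X _

theorem comp_lowerIndex_ne_zero {z : Option (Fin (n + 1) × Fin (n + 1)) → ℂ}
    (hz : z ∈ closureCone (SO (n + 1))) (hz0 : z ≠ 0) : z ∘ lowerIndex n ≠ 0 :=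
  fun h => hz0 ((isGram_of_mem_closureCone hz).eq_zero h)

theorem mk_comp_lowerIndex_mem_toPFun (P : ℙ ℂ (Option (Fin (n + 1) × Fin (n + 1)) → ℂ))
    (h : P.rep ∘ lowerIndex n ≠ 0) :
    Projectivization.mk ℂ _ h ∈ (deleteFirstRow n).toPFun P :=
  ((deleteFirstRow n).mk_mem_toPFun_iff h).2
    ⟨1, one_ne_zero, fun v => by rw [eval_deleteFirstRow_coord, one_mul]⟩

theorem projClosure_SO_subset_dom (n : ℕ) :
    projClosure (SO (n + 1)) ⊆ (deleteFirstRow n).toPFun.Dom := fun P hP =>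
  (PFun.mem_dom _ _).2 ⟨_, mk_comp_lowerIndex_mem_toPFun P
    (comp_lowerIndex_ne_zero (mem_projClosure_iff.1 hP) P.rep_nonzero)⟩

theorem eq_mk_of_mem_toPFun {P : ℙ ℂ (Option (Fin (n + 1) × Fin (n + 1)) → ℂ)}
    {Q : ℙ ℂ (Option (Fin n × Fin (n + 1)) → ℂ)} (hQ : Q ∈ (deleteFirstRow n).toPFun P) :
    ∃ h : P.rep ∘ lowerIndex n ≠ 0, Q = Projectivization.mk ℂ _ h := by
  rw [← Q.mk_rep, (deleteFirstRow n).mk_mem_toPFun_iff Q.rep_nonzero] at hQ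
  obtain ⟨c, hc, hQ⟩ := hQ
  have h1 : P.rep ∘ lowerIndex n = c • Q.rep := by
    funext v
    rw [← eval_deleteFirstRow_coord, hQ v, Pi.smul_apply, smul_eq_mul]
  have h2 : P.rep ∘ lowerIndex n ≠ 0 := by
    rw [h1]
    exact smul_ne_zero hc Q.rep_nonzero
  exact ⟨h2, Q.mk_rep.symm.trans
    ((Projectivization.mk_eq_mk_iff' ℂ _ _ h2 Q.rep_nonzero).2 ⟨c, h1.symm⟩).symm⟩

/-- Every point of the closure of the Stiefel manifold is the image of a point of the closure of
the special orthogonal group. -/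
theorem exists_mem_projClosure_SO {Q : ℙ ℂ (Option (Fin n × Fin (n + 1)) → ℂ)}
    (hQ : Q ∈ projClosure (St n (n + 1))) :
    ∃ P ∈ projClosure (SO (n + 1)), Q ∈ (deleteFirstRow n).toPFun P := by
  obtain ⟨z, hz, hzw⟩ :=
    exists_mem_closureCone_comp_lowerIndex_eq (mem_projClosure_iff.1 hQ) Q.rep_nonzero
  have hz0 : z ≠ 0 := by
    rintro rfl
    exact Q.rep_nonzero hzw.symm
  refine ⟨Projectivization.mk ℂ z hz0, (mk_mem_projClosure_iff hz0).2 hz, ?_⟩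
  exact ((deleteFirstRow n).mem_toPFun_mk_iff hz0).2
    ⟨1, one_ne_zero, fun v => by rw [eval_deleteFirstRow_coord, hzw, one_mul]⟩

theorem image_projClosure_SO (n : ℕ) :
    (deleteFirstRow n).toPFun.image (projClosure (SO (n + 1))) =
      projClosure (St n (n + 1)) := by
  ext Q
  rw [PFun.mem_image]
  constructor
  · rintro ⟨P, hP, hQ⟩
    obtain ⟨h, rfl⟩ := eq_mk_of_mem_toPFun hQ
    exact (mk_mem_projClosure_iff h).2
      (comp_lowerIndex_mem_closureCone (mem_projClosure_iff.1 hP))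
  · exact exists_mem_projClosure_SO

/-- The rational inverse of `deleteFirstRow`, which restores the first row by the maximal minors:
`[B : h] ↦ [minors of B, h ^ (n - 1) B : h ^ n]`. -/
noncomputable def completionMap (n : ℕ) :
    RatMap (Option (Fin n × Fin (n + 1))) (Option (Fin (n + 1) × Fin (n + 1))) where
  deg := n
  coord := fun o => o.elim (X none ^ n) fun p =>
    (Fin.cons (rename some (minorPoly n p.2)) fun i => X none ^ (n - 1) * X (some (i, p.2)) :
      Fin (n + 1) → MvPolynomial (Option (Fin n × Fin (n + 1))) ℂ) p.1
  isHomogeneous := by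
    rintro (_ | ⟨i, c⟩)
    · exact isHomogeneous_X_pow _ _
    · refine Fin.cases ?_ (fun i => ?_) i
      · exact (isHomogeneous_minorPoly c).rename_isHomogeneous
      · have h := (isHomogeneous_X_pow (R := ℂ) (none : Option (Fin n × Fin (n + 1))) (n - 1)).mul
          (isHomogeneous_X ℂ (some (i, c)))
        -- The existence of the row `i` shows that `n` is positive.
        rwa [Nat.sub_add_cancel i.pos] at h

/-- On the cone over the closure of `SO (n + 1)`, deleting and restoring the first row multiplies
the homogeneous coordinates by `h ^ (n - 1) = h ^ n / h`. -/
theorem eval_completionMap_coord {z : Option (Fin (n + 1) × Fin (n + 1)) → ℂ}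
    (hz : z ∈ closureCone (SO (n + 1))) (h0 : z none ≠ 0)
    (u : Option (Fin (n + 1) × Fin (n + 1))) :
    eval (z ∘ lowerIndex n) ((completionMap n).coord u) = z none ^ n / z none * z u := by
  rw [div_mul_eq_mul_div, eq_div_iff h0]
  rcases u with _ | ⟨i, c⟩
  · change eval (z ∘ lowerIndex n) (X none ^ n) * z none = _
    rw [map_pow, eval_X]
    rfl
  · refine Fin.cases ?_ (fun i => ?_) i
    · exact eval_minorPoly_mul_of_mem_closureCone hz c
    · change eval (z ∘ lowerIndex n) (X none ^ (n - 1) * X (some (i, c))) * z none = _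
      rw [map_mul, map_pow, eval_X, eval_X, mul_right_comm]
      change z none ^ (n - 1) * z none * z (some (i.succ, c)) = _
      rw [← pow_succ, Nat.sub_add_cancel i.pos]

theorem isBirationalBetween_deleteFirstRow (n : ℕ) :
    (deleteFirstRow n).IsBirationalBetween (projClosure (SO (n + 1)))
      (projClosure (St n (n + 1))) := by
  have hinv : ∀ P ∈ projClosure (SO (n + 1)), ∀ Q, Q ∈ (deleteFirstRow n).toPFun P →
      (P.rep none ≠ 0 ↔ Q.rep none ≠ 0) ∧
        (P.rep none ≠ 0 → P ∈ (completionMap n).toPFun Q) := by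
    intro P hP Q hQ
    obtain ⟨h, rfl⟩ := eq_mk_of_mem_toPFun hQ
    refine ⟨(rep_mk_none_ne_zero_iff h).symm, fun h0 => ?_⟩
    exact ((completionMap n).mem_toPFun_mk_iff h).2 ⟨P.rep none ^ n / P.rep none,
      div_ne_zero (pow_ne_zero _ h0) h0,
      eval_completionMap_coord (mem_projClosure_iff.1 hP) h0⟩
  refine ⟨completionMap n, _, _, isDenseOpenIn_projClosure _, isDenseOpenIn_projClosure _, ?_, ?_⟩
  · rintro P ⟨hP, h0⟩
    have hQ := mk_comp_lowerIndex_mem_toPFun P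
      (comp_lowerIndex_ne_zero (mem_projClosure_iff.1 hP) P.rep_nonzero)
    refine ⟨_, ⟨?_, ((hinv P hP _ hQ).1).1 h0⟩, hQ, (hinv P hP _ hQ).2 h0⟩
    rw [← image_projClosure_SO]
    exact ⟨P, hP, hQ⟩
  · rintro Q ⟨hQ, h0⟩
    obtain ⟨P, hP, hPQ⟩ := exists_mem_projClosure_SO hQ
    have h1 := (hinv P hP Q hPQ).1.2 h0
    exact ⟨P, ⟨hP, h1⟩, (hinv P hP Q hPQ).2 h1, hPQ⟩

end Projection

end StiefelDegree

/-- For every `n + 1 ≥ 1`, the degrees of `SO(n+1)` and `St(n,n+1)` are equal, and deleting the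
first row is a regular, surjective and birational map from the projective closure of `SO(n+1)` to
that of `St(n,n+1)`. -/
theorem corollary5p1 (n : ℕ) :
    (∃ d : ℕ, StiefelDegree.HasDegree (StiefelDegree.SO (n + 1)) d ∧
      StiefelDegree.HasDegree (StiefelDegree.St n (n + 1)) d) ∧
    StiefelDegree.projClosure (StiefelDegree.SO (n + 1)) ⊆
      (StiefelDegree.deleteFirstRow n).toPFun.Dom ∧
    (StiefelDegree.deleteFirstRow n).toPFun.image
      (StiefelDegree.projClosure (StiefelDegree.SO (n + 1))) =
        StiefelDegree.projClosure (StiefelDegree.St n (n + 1)) ∧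
    (StiefelDegree.deleteFirstRow n).IsBirationalBetween
      (StiefelDegree.projClosure (StiefelDegree.SO (n + 1)))
      (StiefelDegree.projClosure (StiefelDegree.St n (n + 1))) := by
  obtain ⟨d, hd⟩ := StiefelDegree.exists_hasDegree (StiefelDegree.SO (n + 1))
  exact ⟨⟨d, hd, hd.of_hilbertFunction_le (StiefelDegree.St_nonempty n)
      (StiefelDegree.hilbertFunction_St_le_SO n) (StiefelDegree.hilbertFunction_SO_le_St n)⟩,
    StiefelDegree.projClosure_SO_subset_dom n, StiefelDegree.image_projClosure_SO n,
    StiefelDegree.isBirationalBetween_deleteFirstRow n⟩
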